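/- Let $k$ be an algebraically closed field, let $n\ge 0$, and let $M_1,\dots,M_n$ be finitely generated abelian groups. Then there exist a triangular $k$-algebra $A$, with finite connected quiver $Q_A$ without oriented cycles, and presentations $\nu_i : kQ_A \to A$ with kernels $I_i$ (so that $A\cong kQ_A/I_i$), $i=1,\dots,n$, such that $$\pi_1(Q_A,I_i)\cong M_i\qquad\text{for all } i\in\{1,\dots,n\}.$$ Here the following terminology is used. For a finite connected quiver $Q$, $kQ$ is the path algebra (basis: all paths, including a stationary path $e_x$ for each vertex $x$; product: composition, or $0$ if it is not defined) and $F\subseteq kQ$ is the two-sided ideal generated by the arrows. A two-sided ideal $I$ is admissible if $F^m\subseteq I\subseteq F^2$ for some $m\ge 2$. A presentation of $A$ is a surjective morphism of $k$-algebras $\nu: kQ\to A$ whose kernel is admissible; if one exists, then $A$ is finite dimensional, basic and connected, and $Q=Q_A$ is determined by $A$ up to isomorphism. The algebra $A$ is triangular if $Q_A$ has no oriented cycles. A minimal relation of $I$ is an element $\sum_{j=1}^m\lambda_j w_j$ of $I$, where $m\ge2$, the $w_j$ are pairwise distinct paths with a common source and a common target, and $\lambda_j\in k\setminus\{0\}$,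 such that $\sum_{j\in J}\lambda_j w_j\notin I$ for every nonempty proper subset $J\subset\{1,\dots,m\}$. A walk is a composable sequence of arrows and formal inverses of arrows, and homotopy $\sim$ is the smallest equivalence relation on walks such that $\alpha\alpha^{-1}\sim e_x$ and $\alpha^{-1}\alpha\sim e_y$ for every arrow $\alpha:x\to y$; $w_i\sim w_j$ for all $i,j$ whenever $\sum_j\lambda_j w_j$ is a minimal relation of $I$; and $wuw'\sim wvw'$ whenever $u\sim v$ and these compositions are defined. Finally, $\pi_1(Q,I)=\pi_1(Q,I,x)$ is the group of homotopy classes of closed walks at a vertex $x$; as $Q$ is connected, it does not depend on $x$ up to isomorphism. -/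

import Mathlib

/-! # Bound quivers, presentations of algebras and their fundamental groups -/

universe u v w

namespace BoundQuiver

open Quiver

noncomputable section

/-! ## Quivers

Quivers are Mathlib's: `V` is the set of vertices, `x ⟶ y` the set of arrows from `x` to `y`,
and `Quiver.Path x y` the set of paths, composed from left to right. -/

/-- A walk from `x` to `y`: a composable sequence of arrows and formal inverses of arrows. -/
abbrev Walk (V : Type v) [Quiver.{w} V] (x y : Symmetrify V) : Type (max v w) :=
  Path x y

/-- The quiver is nonempty and its underlying graph is connected. -/
def IsConnectedQuiver (V : Type v) [Quiver.{w} V] : Prop :=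
  Nonempty V ∧ ∀ x y : V, Nonempty (Walk V x y)

/-- The quiver has no oriented cycles: every closed path is stationary. -/
def IsAcyclicQuiver (V : Type v) [Quiver.{w} V] : Prop :=
  ∀ (x : V) (p : Path x x), p = Path.nil

/-- An arrow, viewed as a walk of length one. -/
def arrowWalk {V : Type v} [Quiver.{w} V] {x y : V} (a : x ⟶ y) : Walk V x y :=
  @Hom.toPath (Symmetrify V) _ x y (Sum.inl a)

/-- The formal inverse of an arrow, viewed as a walk of length one. -/
def invArrowWalk {V : Type v} [Quiver.{w} V] {x y : V} (a : x ⟶ y) : Walk V y x :=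
  @Hom.toPath (Symmetrify V) _ y x (Sum.inr a)

/-- A path, viewed as a walk. -/
def pathWalk {V : Type v} [Quiver.{w} V] {x y : V} (p : Path x y) : Walk V x y :=
  (Symmetrify.of (V := V)).mapPath p

/-! ## The path algebra -/

/-- The path algebra `kQ`: the `k`-vector space with basis all paths of the quiver. -/
def PathAlgebra (k : Type u) (V : Type v) [Quiver.{w} V] [Field k] : Type (max u v w) :=
  (Σ x : V, Σ y : V, Path x y) →₀ k

namespace PathAlgebra

variable {k : Type u} {V : Type v} [Quiver.{w} V] [Field k]

instance : AddCommGroup (PathAlgebra k V) :=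
  inferInstanceAs (AddCommGroup ((Σ x : V, Σ y : V, Path x y) →₀ k))

instance : Module k (PathAlgebra k V) :=
  inferInstanceAs (Module k ((Σ x : V, Σ y : V, Path x y) →₀ k))

/-- The basis of `kQ` formed by all paths. -/
def pathBasis (k : Type u) (V : Type v) [Quiver.{w} V] [Field k] :
    Module.Basis (Σ x : V, Σ y : V, Path x y) k (PathAlgebra k V) :=
  Module.Basis.ofRepr (LinearEquiv.refl k ((Σ x : V, Σ y : V, Path x y) →₀ k))

/-- The basis element of `kQ` given by a path. -/
def ofPath (k : Type u) {V : Type v} [Quiver.{w} V] [Field k] {x y : V} (p : Path x y) :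
    PathAlgebra k V :=
  pathBasis k V ⟨x, y, p⟩

open Classical in
/-- The product of two basis elements: the composite path if it is defined, `0` otherwise. -/
def basisMul (k : Type u) {V : Type v} [Quiver.{w} V] [Field k]
    (p q : Σ x : V, Σ y : V, Path x y) : PathAlgebra k V :=
  if h : q.1 = p.2.1 then ofPath k (p.2.2.comp (q.2.2.cast h rfl)) else 0

/-- The bilinear extension of `basisMul`. -/
def mulLinear (k : Type u) (V : Type v) [Quiver.{w} V] [Field k] :
    PathAlgebra k V →ₗ[k] PathAlgebra k V →ₗ[k] PathAlgebra k V :=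
  (pathBasis k V).constr k fun p => (pathBasis k V).constr k (basisMul k p)

theorem basisMul_comp {x y z : V} (p : Path x y) (q : Path y z) :
    basisMul k ⟨x, y, p⟩ ⟨y, z, q⟩ = ofPath k (p.comp q) := by
  simp [basisMul]

theorem basisMul_of_ne {x y y' z : V} (p : Path x y) (q : Path y' z) (h : y' ≠ y) :
    basisMul k ⟨x, y, p⟩ ⟨y', z, q⟩ = 0 := by
  simp [basisMul, h]

theorem mulLinear_ofPath {x y y' z : V} (p : Path x y) (q : Path y' z) :
    mulLinear k V (ofPath k p) (ofPath k q) = basisMul k ⟨x, y, p⟩ ⟨y', z, q⟩ := by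
  simp only [mulLinear, ofPath, Module.Basis.constr_basis]

/-- Linear maps out of `kQ` that agree on all paths are equal. -/
theorem linearMap_ext {N : Type*} [AddCommGroup N] [Module k N]
    {f g : PathAlgebra k V →ₗ[k] N}
    (h : ∀ (x y : V) (p : Path x y), f (ofPath k p) = g (ofPath k p)) : f = g := by
  refine (pathBasis k V).ext ?_
  rintro ⟨x, y, p⟩
  exact h x y p

instance : Mul (PathAlgebra k V) := ⟨fun a b => mulLinear k V a b⟩

theorem mul_def (a b : PathAlgebra k V) : a * b = mulLinear k V a b := rfl

theorem ofPath_mul_ofPath {x y z : V} (p : Path x y) (q : Path y z) :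
    ofPath k p * ofPath k q = ofPath k (p.comp q) := by
  rw [mul_def, mulLinear_ofPath, basisMul_comp]

theorem ofPath_mul_ofPath_of_ne {x y y' z : V} (p : Path x y) (q : Path y' z) (h : y' ≠ y) :
    ofPath k p * ofPath k q = 0 := by
  rw [mul_def, mulLinear_ofPath, basisMul_of_ne p q h]

theorem ofPath_mul_assoc {x y x' y' x'' y'' : V} (p : Path x y) (q : Path x' y')
    (r : Path x'' y'') :
    ofPath k p * ofPath k q * ofPath k r = ofPath k p * (ofPath k q * ofPath k r) := by
  have z1 : ∀ a : PathAlgebra k V, (0 : PathAlgebra k V) * a = 0 := fun a => by simp [mul_def]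
  have z2 : ∀ a : PathAlgebra k V, a * (0 : PathAlgebra k V) = 0 := fun a => by simp [mul_def]
  by_cases h : x' = y
  · subst h
    by_cases h' : x'' = y'
    · subst h'
      simp only [ofPath_mul_ofPath, Path.comp_assoc]
    · rw [ofPath_mul_ofPath, ofPath_mul_ofPath_of_ne _ _ h', ofPath_mul_ofPath_of_ne _ _ h', z2]
  · rw [ofPath_mul_ofPath_of_ne _ _ h, z1]
    by_cases h' : x'' = y'
    · subst h'
      rw [ofPath_mul_ofPath, ofPath_mul_ofPath_of_ne _ _ h]
    · rw [ofPath_mul_ofPath_of_ne _ _ h', z2]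

theorem mul_assoc' (a b c : PathAlgebra k V) : a * b * c = a * (b * c) := by
  let L := mulLinear k V
  have h1 : ∀ {x y x' y' : V} (p : Path x y) (q : Path x' y') (c : PathAlgebra k V),
      L (L (ofPath k p) (ofPath k q)) c = L (ofPath k p) (L (ofPath k q) c) := by
    intro x y x' y' p q c
    have : L (L (ofPath k p) (ofPath k q)) = (L (ofPath k p)).comp (L (ofPath k q)) :=
      linearMap_ext fun _ _ r => ofPath_mul_assoc p q r
    exact congrArg (fun f => f c) this
  have h2 : ∀ {x y : V} (p : Path x y) (b c : PathAlgebra k V),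
      L (L (ofPath k p) b) c = L (ofPath k p) (L b c) := by
    intro x y p b c
    have : (L.flip c).comp (L (ofPath k p)) = (L (ofPath k p)).comp (L.flip c) :=
      linearMap_ext fun _ _ q => h1 p q c
    exact congrArg (fun f => f b) this
  have h3 : (L.flip c).comp (L.flip b) = L.flip (L b c) :=
    linearMap_ext fun _ _ p => h2 p b c
  exact congrArg (fun f => f a) h3

variable [Fintype V]

/-- The unit of `kQ`: the sum of all stationary paths. -/
instance : One (PathAlgebra k V) := ⟨∑ x : V, ofPath k (Path.nil : Path x x)⟩

theorem one_def : (1 : PathAlgebra k V) = ∑ x : V, ofPath k (Path.nil : Path x x) := rfl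

theorem one_mul' (a : PathAlgebra k V) : 1 * a = a := by
  have key : mulLinear k V 1 = LinearMap.id := by
    refine linearMap_ext fun x y p => ?_
    rw [one_def, map_sum, LinearMap.sum_apply, Finset.sum_eq_single x]
    · rw [mulLinear_ofPath, basisMul_comp, Path.nil_comp]; rfl
    · intro z _ hz
      rw [mulLinear_ofPath, basisMul_of_ne _ _ hz.symm]
    · intro h; exact absurd (Finset.mem_univ x) h
  exact congrArg (fun f => f a) key

theorem mul_one' (a : PathAlgebra k V) : a * 1 = a := by
  have key : (mulLinear k V).flip 1 = LinearMap.id := by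
    refine linearMap_ext fun x y p => ?_
    rw [LinearMap.flip_apply, one_def, map_sum, Finset.sum_eq_single y]
    · rw [mulLinear_ofPath, basisMul_comp, Path.comp_nil]; rfl
    · intro z _ hz
      rw [mulLinear_ofPath, basisMul_of_ne _ _ hz]
    · intro h; exact absurd (Finset.mem_univ y) h
  exact congrArg (fun f => f a) key

instance : Ring (PathAlgebra k V) where
  __ := (inferInstance : AddCommGroup (PathAlgebra k V))
  mul := (· * ·)
  one := 1
  mul_assoc := mul_assoc'
  one_mul := one_mul'
  mul_one := mul_one'
  left_distrib a b c := map_add (mulLinear k V a) b c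
  right_distrib a b c := by simp [mul_def]
  zero_mul a := by simp [mul_def]
  mul_zero a := by simp [mul_def]

instance : Algebra k (PathAlgebra k V) :=
  Algebra.ofModule (fun r a b => by simp [mul_def]) (fun r a b => by simp [mul_def])

/-- The two-sided ideal `F` of `kQ` generated by the arrows. -/
def arrowIdeal (k : Type u) (V : Type v) [Quiver.{w} V] [Field k] [Fintype V] :
    Ideal (PathAlgebra k V) :=
  TwoSidedIdeal.asIdeal
    (TwoSidedIdeal.span {a | ∃ (x y : V) (e : x ⟶ y), a = ofPath k e.toPath})

/-- A two-sided ideal `I` of `kQ` is admissible if `F ^ m ⊆ I ⊆ F ^ 2` for some `m ≥ 2`. -/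
structure IsAdmissible (I : Ideal (PathAlgebra k V)) : Prop where
  isTwoSided : I.IsTwoSided
  exists_pow_le : ∃ m : ℕ, 2 ≤ m ∧ arrowIdeal k V ^ m ≤ I
  le_sq : I ≤ arrowIdeal k V ^ 2

end PathAlgebra

open PathAlgebra

/-! ## Presentations and triangular algebras -/

/-- A presentation of `A`: a surjective morphism of `k`-algebras `kQ → A` whose kernel is an
admissible ideal, where `Q` is a finite connected quiver. -/
structure IsPresentation {k : Type u} [Field k] {V : Type v} [Quiver.{w} V] [Fintype V]
    {A : Type*} [Ring A] [Algebra k A] (ν : PathAlgebra k V →ₐ[k] A) : Prop where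
  finite_arrows : ∀ x y : V, Finite (x ⟶ y)
  connected : IsConnectedQuiver V
  surjective : Function.Surjective ν
  admissible : IsAdmissible (RingHom.ker ν)

/-- A triangular algebra: an algebra that has a presentation by a finite connected quiver without
oriented cycles. (Having a presentation makes the algebra finite dimensional, basic and connected,
and determines the quiver up to isomorphism.) -/
def IsTriangularAlgebra (k : Type u) [Field k] (A : Type*) [Ring A] [Algebra k A] : Prop :=
  ∃ (V : Type) (_ : Quiver.{0} V) (_ : Fintype V) (ν : PathAlgebra k V →ₐ[k] A),
    IsAcyclicQuiver V ∧ IsPresentation ν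

/-! ## The fundamental group of a bound quiver -/

section FundamentalGroup

variable {k : Type u} [Field k] {V : Type v} [Quiver.{w} V] [Fintype V]

/-- `ρ = ∑ λᵢ wᵢ`, a linear combination of pairwise distinct paths `wᵢ` from `x` to `y` with
nonzero coefficients `λᵢ = ρ wᵢ`, is a minimal relation of `I`: it lies in `I`, has at least two
terms, and none of its nonempty proper partial sums lies in `I`. -/
structure IsMinimalRelation (I : Ideal (PathAlgebra k V)) {x y : V} (ρ : Path x y →₀ k) :
    Prop where
  mem : ∑ p ∈ ρ.support, ρ p • ofPath k p ∈ I
  two_le : 2 ≤ ρ.support.card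
  notMem : ∀ J : Finset (Path x y), J ⊂ ρ.support → J.Nonempty →
    ∑ p ∈ J, ρ p • ofPath k p ∉ I

/-- The homotopy relation: the smallest equivalence relation on walks that satisfies the last four
conditions. -/
inductive Homotopic (I : Ideal (PathAlgebra k V)) :
    ∀ {x y : Symmetrify V}, Walk V x y → Walk V x y → Prop
  | refl {x y : Symmetrify V} (p : Walk V x y) : Homotopic I p p
  | symm {x y : Symmetrify V} {p q : Walk V x y} : Homotopic I p q → Homotopic I q p
  | trans {x y : Symmetrify V} {p q r : Walk V x y} :
      Homotopic I p q → Homotopic I q r → Homotopic I p r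
  | arrow_inv {x y : V} (a : x ⟶ y) :
      Homotopic I ((arrowWalk a).comp (invArrowWalk a)) Path.nil
  | inv_arrow {x y : V} (a : x ⟶ y) :
      Homotopic I ((invArrowWalk a).comp (arrowWalk a)) Path.nil
  | minimal {x y : V} {ρ : Path x y →₀ k} (hρ : IsMinimalRelation I ρ) {p q : Path x y}
      (hp : p ∈ ρ.support) (hq : q ∈ ρ.support) : Homotopic I (pathWalk p) (pathWalk q)
  | congr {x' x y y' : Symmetrify V} (p : Walk V x' x) {q r : Walk V x y} (s : Walk V y y') :
      Homotopic I q r → Homotopic I ((p.comp q).comp s) ((p.comp r).comp s)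

namespace Homotopic

variable {I : Ideal (PathAlgebra k V)}

theorem comp_left {x y z : Symmetrify V} (p : Walk V x y) {q r : Walk V y z}
    (h : Homotopic I q r) :
    Homotopic I (p.comp q) (p.comp r) :=
  congr p Path.nil h

theorem comp_right {x y z : Symmetrify V} {q r : Walk V x y}
    (h : Homotopic I q r) (s : Walk V y z) :
    Homotopic I (q.comp s) (r.comp s) := by
  have := congr Path.nil s h
  rwa [Path.nil_comp, Path.nil_comp] at this

theorem comp {x y z : Symmetrify V} {p p' : Walk V x y} {q q' : Walk V y z}
    (h : Homotopic I p p') (h' : Homotopic I q q') : Homotopic I (p.comp q) (p'.comp q') :=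
  (h.comp_right q).trans (h'.comp_left p')

theorem comp_reverse (I : Ideal (PathAlgebra k V)) {x y : Symmetrify V} (p : Walk V x y) :
    Homotopic I (p.comp p.reverse) Path.nil ∧ Homotopic I (p.reverse.comp p) Path.nil := by
  induction p with
  | nil => exact ⟨refl _, refl _⟩
  | @cons b c p e ih =>
    have he : p.cons e = p.comp (@Hom.toPath (Symmetrify V) _ _ _ e) := rfl
    rw [he, Path.reverse_comp, Path.reverse_toPath]
    have hee : Homotopic I ((@Hom.toPath (Symmetrify V) _ _ _ e).comp
          (@Hom.toPath (Symmetrify V) _ _ _ (reverse e))) Path.nil ∧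
        Homotopic I ((@Hom.toPath (Symmetrify V) _ _ _ (reverse e)).comp
          (@Hom.toPath (Symmetrify V) _ _ _ e)) Path.nil := by
      rcases e with a | a
      · exact ⟨arrow_inv a, inv_arrow a⟩
      · exact ⟨inv_arrow a, arrow_inv a⟩
    constructor
    · have := congr p p.reverse hee.1
      rw [Path.comp_nil, Path.comp_assoc, Path.comp_assoc] at this
      rw [Path.comp_assoc]
      exact this.trans ih.1
    · have := congr (@Hom.toPath (Symmetrify V) _ _ _ (reverse e))
        (@Hom.toPath (Symmetrify V) _ _ _ e) ih.2
      rw [Path.comp_nil, Path.comp_assoc, Path.comp_assoc] at this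
      rw [Path.comp_assoc]
      exact this.trans hee.2

theorem reverse {x y : Symmetrify V} {p q : Walk V x y} (h : Homotopic I p q) :
    Homotopic I p.reverse q.reverse := by
  have h1 := ((comp_reverse I q).1.symm).comp_left p.reverse
  rw [Path.comp_nil, ← Path.comp_assoc] at h1
  have h2 := ((h.symm.comp_left p.reverse).trans (comp_reverse I p).2).comp_right q.reverse
  rw [Path.nil_comp] at h2
  exact h1.trans h2

end Homotopic

/-- Homotopy of closed walks at `x`. -/
def homotopySetoid (I : Ideal (PathAlgebra k V)) (x : V) : Setoid (Walk V x x) where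
  r := Homotopic I
  iseqv := ⟨Homotopic.refl, Homotopic.symm, Homotopic.trans⟩

/-- The fundamental group `π₁(Q, I, x)`: closed walks at `x` modulo homotopy. -/
def FundamentalGroup (I : Ideal (PathAlgebra k V)) (x : V) : Type (max v w) :=
  Quotient (homotopySetoid I x)

/-- The group structure is induced by the composition of walks. -/
instance (I : Ideal (PathAlgebra k V)) (x : V) : Group (FundamentalGroup I x) where
  mul := Quotient.map₂ Path.comp fun _ _ h _ _ h' => Homotopic.comp h h'
  one := Quotient.mk (homotopySetoid I x) Path.nil
  inv := Quotient.map Path.reverse fun _ _ h => Homotopic.reverse h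
  mul_assoc := by
    rintro ⟨a⟩ ⟨b⟩ ⟨c⟩
    exact congrArg (Quotient.mk (homotopySetoid I x)) (Path.comp_assoc a b c)
  one_mul := by
    rintro ⟨a⟩
    exact congrArg (Quotient.mk (homotopySetoid I x)) (Path.nil_comp a)
  mul_one := by
    rintro ⟨a⟩
    exact congrArg (Quotient.mk (homotopySetoid I x)) (Path.comp_nil a)
  inv_mul_cancel := by
    rintro ⟨a⟩
    exact Quotient.sound (Homotopic.comp_reverse I a).2

end FundamentalGroup

end

end BoundQuiver

/-
A finitely presented group `M` is presented by finitely many generators `σ t`, `t : T`, and the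
relations `σ s * σ t = σ r` that hold in `M`; finitely many groups can share the index set `T`. Take
a quiver `source ⟶ middle ⟶ target` with first arrows `s` and `(s, t, r)` and second arrows `t` and
`1`, and for `ε : T × T × T → k` the ideal generated by

  `(s, t, r) · t = ε (s, t, r) • s · t + r · 1`,  `(s, t, r) · c = ε (s, t, r) • s · c` for `c ≠ t`.

The automorphism of `kQ` that sends the arrow `(s, t, r)` to `(s, t, r) + ε (s, t, r) • s` carries
this ideal to the one for `ε = 0`, so all `ε` give presentations of one algebra. In the fundamental
group the auxiliary arrow `(s, t, r)` can be eliminated, and what remains is the relation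
`s * t = r` exactly when `ε (s, t, r) ≠ 0`: a suitable `ε` with values `0` and `1` produces `M`.
-/

namespace BoundQuiver

open Quiver PathAlgebra

/-! ## Multiplication tables of finitely presented groups -/

section FinitelyPresented

open scoped commutatorElement

theorem commutator_isFinitelyNormallyGenerated (G : Type*) [Group G] [Group.FG G] :
    (commutator G).IsFinitelyNormallyGenerated := by
  obtain ⟨S, hS, hSfin⟩ := Group.fg_iff.mp ‹Group.FG G›
  let R : Set G := Set.image2 (fun s t => ⁅s, t⁆) S S
  let N := Subgroup.normalClosure R
  have commute_of_mem : ∀ s ∈ S, ∀ t ∈ S, (s : G ⧸ N) * t = t * s := fun s hs t ht => by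
    rw [← commutatorElement_eq_one_iff_mul_comm]
    exact (QuotientGroup.eq_one_iff _).2
      (Subgroup.subset_normalClosure (Set.mem_image2_of_mem hs ht))
  have closure_eq_top : Subgroup.closure ((↑) '' S : Set (G ⧸ N)) = ⊤ := by
    have := (MonoidHom.map_closure (QuotientGroup.mk' N) S).symm
    rwa [hS, Subgroup.map_top_of_surjective _ (QuotientGroup.mk'_surjective N)] at this
  have comm : IsMulCommutative (Subgroup.closure ((↑) '' S : Set (G ⧸ N))) := by
    refine Subgroup.isMulCommutative_closure ?_
    rintro _ ⟨s, hs, rfl⟩ _ ⟨t, ht, rfl⟩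
    exact commute_of_mem s hs t ht
  refine ⟨R, hSfin.image2 _ hSfin, le_antisymm ?_ ?_⟩
  · refine Subgroup.normalClosure_le_normal ?_
    rintro _ ⟨s, -, t, -, rfl⟩
    exact Subgroup.commutator_mem_commutator (Subgroup.mem_top s) (Subgroup.mem_top t)
  · refine Subgroup.Normal.quotient_commutative_iff_commutator_le.1 ⟨⟨fun a b => ?_⟩⟩
    rw [closure_eq_top] at comm
    exact setLike_mul_comm (s := (⊤ : Subgroup (G ⧸ N))) (Subgroup.mem_top a) (Subgroup.mem_top b)

theorem subgroup_fg_of_commGroup {G : Type*} [CommGroup G] [Group.FG G] (H : Subgroup G) :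
    Group.FG H := by
  have : Module.Finite ℤ (Additive G) := Module.Finite.iff_addGroup_fg.2 inferInstance
  have := (Submodule.fg_iff_addSubgroup_fg _).1
    (IsNoetherian.noetherian (AddSubgroup.toIntSubmodule H.toAddSubgroup))
  exact (Group.fg_iff_subgroup_fg H).2 ((Subgroup.fg_iff_add_fg H).2 this)

instance (G : Type*) [CommGroup G] [Group.FG G] : Group.IsFinitelyPresented G := by
  obtain ⟨S, _, f, hf⟩ := Group.fg_iff_exists_freeGroup_hom_surjective_finite.1 ‹Group.FG G›
  have : Group.IsFinitelyPresented (Abelianization (FreeGroup S)) :=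
    Group.IsFinitelyPresented.quotient _ (commutator_isFinitelyNormallyGenerated _)
  have : Group.FG (Abelianization (FreeGroup S)) :=
    Group.fg_of_surjective (f := Abelianization.of) (QuotientGroup.mk'_surjective _)
  have := subgroup_fg_of_commGroup (Abelianization.lift f).ker
  exact Group.IsFinitelyPresented.of_surjective (Abelianization.lift f)
    (fun g => (hf g).imp' Abelianization.of fun w hw => by rw [Abelianization.lift_apply_of, hw])
    (.of_FG _)

end FinitelyPresented

section Table

/-- The group `M` is presented by the generators `σ t` and those relations `σ s * σ t = σ r` that
hold in `M`, and some `σ t` is `1`. The group `H` ranges over the universe of `T` only, which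
contains the group defined by this presentation. -/
structure IsTablePresentation {T : Type u} {M : Type v} [Group M] (σ : T → M) : Prop where
  exists_eq_one : ∃ t, σ t = 1
  closure_range : Subgroup.closure (Set.range σ) = ⊤
  exists_hom {H : Type u} [Group H] (f : T → H)
    (hf : ∀ s t r, σ s * σ t = σ r → f s * f t = f r) : ∃ φ : M →* H, ∀ t, φ (σ t) = f t

namespace IsTablePresentation

variable {T T' : Type u} {M : Type v} [Group M]

theorem comp_surjective {σ : T → M} (hσ : IsTablePresentation σ) {g : T' → T}
    (hg : Function.Surjective g) : IsTablePresentation (σ ∘ g) where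
  exists_eq_one := by
    obtain ⟨t, ht⟩ := hσ.exists_eq_one
    obtain ⟨t', rfl⟩ := hg t
    exact ⟨t', ht⟩
  closure_range := by rw [hg.range_comp, hσ.closure_range]
  exists_hom f hf := by
    obtain ⟨o, ho⟩ := hσ.exists_eq_one
    obtain ⟨o, rfl⟩ := hg o
    have f_one : f o = 1 := mul_eq_left.1 (hf o o o (by simp [ho]))
    have f_congr : ∀ s t, σ (g s) = σ (g t) → f s = f t := fun s t h => by
      simpa only [f_one, mul_one] using hf s o t (by simp [ho, h])
    obtain ⟨φ, hφ⟩ := hσ.exists_hom (fun t => f (Function.surjInv hg t)) fun s t r h =>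
      hf _ _ _ (by simpa only [Function.comp_apply, Function.surjInv_eq hg] using h)
    exact ⟨φ, fun t => (hφ (g t)).trans (f_congr _ t (congrArg σ (Function.surjInv_eq hg (g t))))⟩

/-- The words of length at most `N` in the letters of `α` and their formal inverses. -/
abbrev BoundedWord (α : Type u) (N : ℕ) : Type u :=
  {l : List (α × Bool) // l.length ≤ N}

theorem eq_lift_of_boundedWord {α : Type u} {N : ℕ} (hN : 1 ≤ N) {H : Type*} [Group H]
    (φ : FreeGroup α →* M) (f : BoundedWord α N → H)
    (hf : ∀ s t r : BoundedWord α N, φ (.mk s.1) * φ (.mk t.1) = φ (.mk r.1) → f s * f t = f r)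
    (l : BoundedWord α N) :
    f l = FreeGroup.lift (fun a => f ⟨[(a, true)], hN⟩) (.mk l.1) := by
  set ψ := FreeGroup.lift fun a => f ⟨[(a, true)], hN⟩
  have φ_nil : φ (.mk []) = 1 := map_one φ
  have f_nil : f ⟨[], N.zero_le⟩ = 1 :=
    mul_eq_left.1 (hf ⟨[], N.zero_le⟩ ⟨[], N.zero_le⟩ ⟨[], N.zero_le⟩ (by rw [φ_nil, mul_one]))
  have f_letter : ∀ a b, f ⟨[(a, b)], hN⟩ = ψ (.mk [(a, b)])
    | a, true => FreeGroup.lift_apply_of.symm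
    | a, false => by
      have cancel : f ⟨[(a, true)], hN⟩ * f ⟨[(a, false)], hN⟩ = 1 := f_nil ▸ hf _ _ ⟨[], _⟩
        ((map_mul φ _ _).symm.trans (congrArg φ (mul_inv_cancel (FreeGroup.of a))))
      calc f ⟨[(a, false)], hN⟩ = (ψ (.of a))⁻¹ := by
            rw [eq_inv_of_mul_eq_one_right cancel, FreeGroup.lift_apply_of]
        _ = ψ (.mk [(a, false)]) := (map_inv ψ _).symm
  obtain ⟨l, hl⟩ := l
  induction l with
  | nil => exact f_nil.trans (map_one ψ).symm
  | cons x l ih =>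
    have hl' : l.length ≤ N := Nat.le_of_succ_le hl
    calc f ⟨x :: l, hl⟩ = f ⟨[x], hN⟩ * f ⟨l, hl'⟩ := (hf _ _ _ (map_mul φ _ _).symm).symm
      _ = ψ (.mk [x]) * ψ (.mk l) := by rw [f_letter, ih]
      _ = ψ (.mk (x :: l)) := (map_mul ψ _ _).symm

theorem of_boundedWord {α : Type u} [DecidableEq α] {N : ℕ} (hN : 1 ≤ N) {φ : FreeGroup α →* M}
    (hφ : Function.Surjective φ) {R : Set (FreeGroup α)} (hR : Subgroup.normalClosure R = φ.ker)
    (hRN : ∀ w ∈ R, w.toWord.length ≤ N) :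
    IsTablePresentation fun l : BoundedWord α N => φ (.mk l.1) where
  exists_eq_one := ⟨⟨[], N.zero_le⟩, by rw [← FreeGroup.one_eq_mk, map_one]⟩
  closure_range := by
    rw [eq_top_iff, ← MonoidHom.range_eq_top.2 hφ, MonoidHom.range_eq_map,
      ← FreeGroup.closure_range_of, MonoidHom.map_closure, ← Set.range_comp]
    refine Subgroup.closure_mono (Set.range_subset_iff.2 fun a => ?_)
    exact ⟨⟨[(a, true)], hN⟩, rfl⟩
  exists_hom {H} _ f hf := by
    let ψ : FreeGroup α →* H := FreeGroup.lift fun a => f ⟨[(a, true)], hN⟩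
    have f_eq : ∀ l, f l = ψ (.mk l.1) := eq_lift_of_boundedWord hN φ f hf
    have ker_le : φ.ker ≤ ψ.ker := by
      rw [← hR]
      refine Subgroup.normalClosure_le_normal fun w hw => ?_
      have φ_w : φ w = 1 := MonoidHom.mem_ker.1 (hR ▸ Subgroup.subset_normalClosure hw)
      have := hf ⟨w.toWord, hRN w hw⟩ ⟨w.toWord, hRN w hw⟩ ⟨w.toWord, hRN w hw⟩
        (by simp [FreeGroup.mk_toWord, φ_w])
      rw [f_eq, FreeGroup.mk_toWord] at this
      exact mul_eq_left.1 this
    refine ⟨φ.liftOfSurjective hφ ⟨ψ, ker_le⟩, fun l => ?_⟩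
    rw [f_eq]
    exact φ.liftOfRightInverse_comp_apply _ _ ⟨ψ, ker_le⟩ _

theorem exists_of_isFinitelyPresented (M : Type v) [Group M] [Group.IsFinitelyPresented M] :
    ∃ (T : Type) (_ : Finite T) (σ : T → M), IsTablePresentation σ := by
  obtain ⟨n, φ, hφ, R, hRfin, hR⟩ := Group.IsFinitelyPresented.out (G := M)
  obtain ⟨N, hN⟩ := (hRfin.image fun w => w.toWord.length).bddAbove
  exact ⟨BoundedWord (Fin n) (N + 1), List.finite_length_le _ _, _,
    of_boundedWord N.succ_pos hφ hR fun w hw => (hN ⟨w, hw, rfl⟩).trans N.le_succ⟩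

end IsTablePresentation

end Table

noncomputable section

/-! ## Path algebras -/

namespace PathAlgebra

section Lift

variable {k : Type u} [Field k] {V : Type v} [Quiver.{w} V]

section Weight

variable {B : Type*} [Semiring B] {e : V → B} {f : ∀ {x y : V}, (x ⟶ y) → B}

theorem mul_weight_mul_self (he : ∀ x, IsIdempotentElem (e x))
    (hf : ∀ {x y : V} (a : x ⟶ y), f a * e y = f a) {x y : V} (p : Path x y) :
    e x * p.weight f * e y = e x * p.weight f := by
  cases p with
  | nil => rw [Path.weight_nil, mul_one, he x]
  | cons p a => rw [Path.weight_cons, mul_assoc, mul_assoc, hf]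

theorem mul_weight_mul_mul_weight (he : ∀ x, IsIdempotentElem (e x))
    (hf : ∀ {x y : V} (a : x ⟶ y), f a * e y = f a) {x y z : V} (p : Path x y) (q : Path y z) :
    e x * p.weight f * (e y * q.weight f) = e x * (p.comp q).weight f := by
  rw [← mul_assoc, mul_weight_mul_self he hf, Path.weight_comp, mul_assoc]

theorem mul_weight_mul_mul_weight_of_ne (he : OrthogonalIdempotents e)
    (hf : ∀ {x y : V} (a : x ⟶ y), f a * e y = f a) {x y x' y' : V} (h : x' ≠ y)
    (p : Path x y) (q : Path x' y') :
    e x * p.weight f * (e x' * q.weight f) = 0 := by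
  rw [← mul_weight_mul_self he.idem hf p, mul_assoc, ← mul_assoc (e y), he.ortho h.symm,
    zero_mul, mul_zero]

end Weight

variable [Fintype V] {B : Type*} [Ring B] [Algebra k B] {e : V → B} {f : ∀ {x y : V}, (x ⟶ y) → B}

/-- The morphism of algebras out of `kQ` that sends the stationary path at `x` to `e x` and an
arrow `a` starting at `x` to `e x * f a`. -/
def lift (k : Type u) [Field k] [Algebra k B] (e : V → B) (f : ∀ {x y : V}, (x ⟶ y) → B)
    (he : CompleteOrthogonalIdempotents e) (hf : ∀ {x y : V} (a : x ⟶ y), f a * e y = f a) :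
    PathAlgebra k V →ₐ[k] B :=
  AlgHom.ofLinearMap ((pathBasis k V).constr k fun p => e p.1 * p.2.2.weight f)
    (by
      rw [one_def, map_sum, ← he.complete]
      exact Finset.sum_congr rfl fun x _ => by
        rw [ofPath, Module.Basis.constr_basis, Path.weight_nil, mul_one])
    (by
      set F := (pathBasis k V).constr k fun p => e p.1 * p.2.2.weight f
      have F_ofPath : ∀ {x y : V} (p : Path x y), F (ofPath k p) = e x * p.weight f := fun p => by
        simp only [F, ofPath, Module.Basis.constr_basis]
      have F_mul : (mulLinear k V).compr₂ F = (LinearMap.mul k B).compl₁₂ F F := by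
        refine linearMap_ext fun x y p => linearMap_ext fun x' y' q => ?_
        rw [LinearMap.compr₂_apply, LinearMap.compl₁₂_apply, LinearMap.mul_apply', F_ofPath,
          F_ofPath, ← mul_def]
        obtain rfl | h := eq_or_ne x' y
        · rw [ofPath_mul_ofPath, F_ofPath, mul_weight_mul_mul_weight he.idem hf]
        · rw [ofPath_mul_ofPath_of_ne _ _ h, map_zero,
            mul_weight_mul_mul_weight_of_ne he.toOrthogonalIdempotents hf h]
      exact fun a b => LinearMap.congr_fun₂ F_mul a b)

theorem lift_ofPath (he : CompleteOrthogonalIdempotents e)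
    (hf : ∀ {x y : V} (a : x ⟶ y), f a * e y = f a) {x y : V} (p : Path x y) :
    lift k e f he hf (ofPath k p) = e x * p.weight f :=
  (pathBasis k V).constr_basis k _ ⟨x, y, p⟩

theorem lift_ofPath_nil (he : CompleteOrthogonalIdempotents e)
    (hf : ∀ {x y : V} (a : x ⟶ y), f a * e y = f a) (x : V) :
    lift k e f he hf (ofPath k (Path.nil : Path x x)) = e x := by
  rw [lift_ofPath, Path.weight_nil, mul_one]

theorem lift_ofPath_toPath (he : CompleteOrthogonalIdempotents e)
    (hf : ∀ {x y : V} (a : x ⟶ y), f a * e y = f a) {x y : V} (a : x ⟶ y) :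
    lift k e f he hf (ofPath k a.toPath) = e x * f a := by
  rw [lift_ofPath, Hom.toPath, Path.weight_cons, Path.weight_nil, one_mul]

theorem algHom_ext {φ ψ : PathAlgebra k V →ₐ[k] B}
    (hnil : ∀ x : V, φ (ofPath k (Path.nil : Path x x)) = ψ (ofPath k (Path.nil : Path x x)))
    (harrow : ∀ {x y : V} (a : x ⟶ y), φ (ofPath k a.toPath) = ψ (ofPath k a.toPath)) :
    φ = ψ := by
  refine AlgHom.toLinearMap_injective (linearMap_ext fun x y p => ?_)
  induction p with
  | nil => exact hnil x
  | cons p a ih =>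
    have factor : ofPath k (p.cons a) = ofPath k p * ofPath k a.toPath :=
      (ofPath_mul_ofPath p a.toPath).symm
    simp only [AlgHom.toLinearMap_apply] at ih ⊢
    rw [factor, map_mul, map_mul, ih, harrow]

variable (k V)

theorem completeOrthogonalIdempotents_ofPath_nil :
    CompleteOrthogonalIdempotents fun x : V => ofPath k (Path.nil : Path x x) where
  idem _ := ofPath_mul_ofPath _ _
  ortho _ _ h := ofPath_mul_ofPath_of_ne _ _ h.symm
  complete := one_def.symm

end Lift

section Length

variable (k : Type u) [Field k] (V : Type v) [Quiver.{w} V]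

/-- The subspace of `kQ` spanned by the paths of length at least `m`. -/
def lengthFiltration (m : ℕ) : Submodule k (PathAlgebra k V) :=
  Submodule.span k {a | ∃ (x y : V) (p : Path x y), m ≤ p.length ∧ ofPath k p = a}

variable {k V}

theorem ofPath_mem_lengthFiltration {m : ℕ} {x y : V} {p : Path x y} (hp : m ≤ p.length) :
    ofPath k p ∈ lengthFiltration k V m :=
  Submodule.subset_span ⟨x, y, p, hp, rfl⟩

theorem mem_lengthFiltration_zero (a : PathAlgebra k V) : a ∈ lengthFiltration k V 0 := by
  refine Submodule.span_mono ?_ ((pathBasis k V).mem_span a)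
  rintro _ ⟨⟨x, y, p⟩, rfl⟩
  exact ⟨x, y, p, p.length.zero_le, rfl⟩

theorem lengthFiltration_eq_bot {m : ℕ} (h : ∀ {x y : V} (p : Path x y), p.length < m) :
    lengthFiltration k V m = ⊥ := by
  rw [lengthFiltration, Submodule.span_eq_bot]
  rintro _ ⟨x, y, p, hp, rfl⟩
  exact absurd hp (h p).not_ge

variable [Fintype V]

theorem mul_mem_lengthFiltration {m n : ℕ} {a b : PathAlgebra k V}
    (ha : a ∈ lengthFiltration k V m) (hb : b ∈ lengthFiltration k V n) :
    a * b ∈ lengthFiltration k V (m + n) := by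
  refine (Submodule.span_mul_span k _ _).trans_le (Submodule.span_le.2 ?_)
    (Submodule.mul_mem_mul ha hb)
  rintro _ ⟨_, ⟨x, y, p, hp, rfl⟩, _, ⟨x', y', q, hq, rfl⟩, rfl⟩
  obtain rfl | h := eq_or_ne x' y
  · simp only [ofPath_mul_ofPath]
    exact ofPath_mem_lengthFiltration ((add_le_add hp hq).trans_eq (Path.length_comp p q).symm)
  · simp only [ofPath_mul_ofPath_of_ne _ _ h]
    exact Submodule.zero_mem _

theorem ofPath_toPath_mem_arrowIdeal {x y : V} (a : x ⟶ y) :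
    ofPath k a.toPath ∈ arrowIdeal k V :=
  TwoSidedIdeal.subset_span ⟨x, y, a, rfl⟩

theorem mem_lengthFiltration_one_of_mem_arrowIdeal {a : PathAlgebra k V}
    (ha : a ∈ arrowIdeal k V) : a ∈ lengthFiltration k V 1 := by
  let J : TwoSidedIdeal (PathAlgebra k V) :=
    TwoSidedIdeal.mk' (lengthFiltration k V 1 : Set (PathAlgebra k V))
      (Submodule.zero_mem _) (Submodule.add_mem _) (Submodule.neg_mem _)
      (fun {b _} ha => zero_add 1 ▸ mul_mem_lengthFiltration (mem_lengthFiltration_zero b) ha)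
      (fun {_ b} ha => add_zero 1 ▸ mul_mem_lengthFiltration ha (mem_lengthFiltration_zero b))
  have arrows_le : TwoSidedIdeal.span {a | ∃ (x y : V) (e : x ⟶ y), a = ofPath k e.toPath} ≤ J := by
    rw [TwoSidedIdeal.span_le]
    rintro _ ⟨x, y, e, rfl⟩
    exact (TwoSidedIdeal.mem_mk' ..).2 (ofPath_mem_lengthFiltration le_rfl)
  exact (TwoSidedIdeal.mem_mk' ..).1 (arrows_le ha)

theorem mem_lengthFiltration_of_mem_arrowIdeal_pow {m : ℕ} {a : PathAlgebra k V}
    (ha : a ∈ arrowIdeal k V ^ m) : a ∈ lengthFiltration k V m := by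
  induction m generalizing a with
  | zero => exact mem_lengthFiltration_zero a
  | succ m ih =>
    obtain rfl | hm := eq_or_ne m 0
    · rw [zero_add, Submodule.pow_one] at ha
      exact mem_lengthFiltration_one_of_mem_arrowIdeal ha
    rw [Submodule.pow_succ] at ha
    induction ha using Submodule.mul_induction_on' with
    | mem_mul_mem a ha b hb =>
      exact mul_mem_lengthFiltration (ih ha) (mem_lengthFiltration_one_of_mem_arrowIdeal hb)
    | add a _ b _ ha hb => exact Submodule.add_mem _ ha hb

theorem arrowIdeal_pow_eq_bot {m : ℕ} (h : ∀ {x y : V} (p : Path x y), p.length < m) :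
    arrowIdeal k V ^ m = ⊥ :=
  eq_bot_iff.2 fun _ ha =>
    (lengthFiltration_eq_bot (k := k) h).le (mem_lengthFiltration_of_mem_arrowIdeal_pow ha)

end Length

section RelationIdeal

variable {k : Type u} [Field k] {V : Type v} [Quiver.{w} V] {x y : V}

variable (k x y) in
/-- The inclusion in `kQ` of the linear combinations of paths from `x` to `y`. -/
abbrev ofParallelPaths : (Path x y →₀ k) →ₗ[k] PathAlgebra k V :=
  Finsupp.linearCombination k (ofPath k)

theorem ofParallelPaths_injective : Function.Injective (ofParallelPaths k x y) := by
  have : Function.Injective fun p : Path x y => (⟨x, y, p⟩ : Σ x y : V, Path x y) :=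
    fun p q h => by simpa using h
  exact (pathBasis k V).linearIndependent.comp _ this

variable [Fintype V]

theorem ofPath_nil_mul_ofParallelPaths (c : Path x y →₀ k) :
    ofPath k (Path.nil : Path x x) * ofParallelPaths k x y c = ofParallelPaths k x y c := by
  simp only [Finsupp.linearCombination_apply, Finsupp.sum, Finset.mul_sum, mul_smul_comm,
    ofPath_mul_ofPath, Path.nil_comp]

theorem ofParallelPaths_mul_ofPath_nil (c : Path x y →₀ k) :
    ofParallelPaths k x y c * ofPath k (Path.nil : Path y y) = ofParallelPaths k x y c := by
  simp only [Finsupp.linearCombination_apply, Finsupp.sum, Finset.sum_mul, smul_mul_assoc,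
    ofPath_mul_ofPath, Path.comp_nil]

theorem ofPath_mul_ofParallelPaths_of_ne {u v : V} (h : x ≠ v) (q : Path u v)
    (c : Path x y →₀ k) : ofPath k q * ofParallelPaths k x y c = 0 := by
  simp only [Finsupp.linearCombination_apply, Finsupp.sum, Finset.mul_sum, mul_smul_comm,
    ofPath_mul_ofPath_of_ne _ _ h, smul_zero, Finset.sum_const_zero]

theorem ofParallelPaths_mul_ofPath_of_ne {u v : V} (h : u ≠ y) (c : Path x y →₀ k)
    (q : Path u v) : ofParallelPaths k x y c * ofPath k q = 0 := by
  simp only [Finsupp.linearCombination_apply, Finsupp.sum, Finset.sum_mul, smul_mul_assoc,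
    ofPath_mul_ofPath_of_ne _ _ h, smul_zero, Finset.sum_const_zero]

theorem eq_zero_of_ofParallelPaths_eq {x' y' : V} {c : Path x y →₀ k} {c' : Path x' y' →₀ k}
    (h : ofParallelPaths k x y c = ofParallelPaths k x' y' c') (hne : x ≠ x' ∨ y ≠ y') :
    c = 0 := by
  refine ofParallelPaths_injective ?_
  rw [map_zero]
  obtain hx | hy := hne
  · rw [← ofPath_nil_mul_ofParallelPaths, h, ofPath_mul_ofParallelPaths_of_ne hx.symm]
  · rw [← ofParallelPaths_mul_ofPath_nil, h, ofParallelPaths_mul_ofPath_of_ne hy]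

theorem ofPath_mul_mem_map_ofParallelPaths (hx : ∀ u : V, IsEmpty (u ⟶ x))
    (W : Submodule k (Path x y →₀ k)) {u v : V} (q : Path u v) {b : PathAlgebra k V}
    (hb : b ∈ W.map (ofParallelPaths k x y)) : ofPath k q * b ∈ W.map (ofParallelPaths k x y) := by
  obtain ⟨c, hc, rfl⟩ := hb
  obtain rfl | h := eq_or_ne x v
  · cases q with
    | nil => exact ⟨c, hc, (ofPath_nil_mul_ofParallelPaths c).symm⟩
    | cons _ a => exact (hx _).elim a
  · rw [ofPath_mul_ofParallelPaths_of_ne h]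
    exact Submodule.zero_mem _

theorem mul_ofPath_mem_map_ofParallelPaths (hy : ∀ v : V, IsEmpty (y ⟶ v))
    (W : Submodule k (Path x y →₀ k)) {u v : V} (q : Path u v) {b : PathAlgebra k V}
    (hb : b ∈ W.map (ofParallelPaths k x y)) : b * ofPath k q ∈ W.map (ofParallelPaths k x y) := by
  induction q with
  | nil =>
    obtain ⟨c, hc, rfl⟩ := hb
    obtain rfl | h := eq_or_ne u y
    · exact ⟨c, hc, (ofParallelPaths_mul_ofPath_nil c).symm⟩
    · rw [ofParallelPaths_mul_ofPath_of_ne h]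
      exact Submodule.zero_mem _
  | @cons v w q a ih =>
    have factor : ofPath k (q.cons a) = ofPath k q * ofPath k a.toPath :=
      (ofPath_mul_ofPath q a.toPath).symm
    obtain ⟨c, -, hc⟩ := ih
    have h : v ≠ y := by
      rintro rfl
      exact (hy w).false a
    rw [factor, ← mul_assoc, ← hc, ofParallelPaths_mul_ofPath_of_ne h]
    exact Submodule.zero_mem _

/-- The two-sided ideal of `kQ` formed by the linear combinations of paths from `x` to `y` that lie
in `W`, where `x` is a source of the quiver (and `y` a sink). -/
def relationIdeal (hx : ∀ u : V, IsEmpty (u ⟶ x)) (W : Submodule k (Path x y →₀ k)) :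
    Ideal (PathAlgebra k V) where
  __ := W.map (ofParallelPaths k x y)
  smul_mem' a b hb := by
    induction (pathBasis k V).mem_span a using Submodule.span_induction with
    | mem a ha =>
      obtain ⟨⟨u, v, q⟩, rfl⟩ := ha
      exact ofPath_mul_mem_map_ofParallelPaths hx W q hb
    | zero => rw [zero_smul]; exact Submodule.zero_mem _
    | add a b _ _ ha hb => rw [add_smul]; exact Submodule.add_mem _ ha hb
    | smul r a _ ha => rw [smul_assoc]; exact Submodule.smul_mem _ r ha

theorem mem_relationIdeal {hx : ∀ u : V, IsEmpty (u ⟶ x)} {W : Submodule k (Path x y →₀ k)}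
    {a : PathAlgebra k V} : a ∈ relationIdeal hx W ↔ ∃ c ∈ W, ofParallelPaths k x y c = a :=
  Iff.rfl

theorem isTwoSided_relationIdeal (hx : ∀ u : V, IsEmpty (u ⟶ x)) (hy : ∀ v : V, IsEmpty (y ⟶ v))
    (W : Submodule k (Path x y →₀ k)) : (relationIdeal hx W).IsTwoSided where
  mul_mem_of_left {a} b ha := by
    induction (pathBasis k V).mem_span b using Submodule.span_induction with
    | mem b hb =>
      obtain ⟨⟨u, v, q⟩, rfl⟩ := hb
      exact mul_ofPath_mem_map_ofParallelPaths hy W q ha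
    | zero => rw [mul_zero]; exact Submodule.zero_mem _
    | add b b' _ _ hb hb' => rw [mul_add]; exact Submodule.add_mem _ hb hb'
    | smul r b _ hb => rw [mul_smul_comm]; exact Submodule.smul_of_tower_mem _ r hb

end RelationIdeal

end PathAlgebra

/-! ## Fundamental groups and gradings -/

section Weight

variable {V : Type v} [Quiver.{w} V] {G : Type*} [Group G]

/-- The product of the weights of the arrows of a walk, where a formal inverse of an arrow has the
inverse weight. -/
def walkWeight (ω : ∀ {x y : V}, (x ⟶ y) → G) {x y : Symmetrify V} (p : Walk V x y) : G :=
  p.weight fun {_ _} => Sum.elim ω fun a => (ω a)⁻¹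

variable (ω : ∀ {x y : V}, (x ⟶ y) → G)

theorem walkWeight_nil {x : Symmetrify V} : walkWeight ω (Path.nil : Walk V x x) = 1 :=
  Path.weight_nil _ x

theorem walkWeight_comp {x y z : Symmetrify V} (p : Walk V x y) (q : Walk V y z) :
    walkWeight ω (p.comp q) = walkWeight ω p * walkWeight ω q :=
  Path.weight_comp _ p q

theorem walkWeight_comp_arrowWalk {x : Symmetrify V} {y z : V} (p : Walk V x y) (a : y ⟶ z) :
    walkWeight ω (p.comp (arrowWalk a)) = walkWeight ω p * ω a :=
  Path.weight_cons (V := Symmetrify V) _ p (Sum.inl a)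

theorem walkWeight_comp_invArrowWalk {x : Symmetrify V} {y z : V} (p : Walk V x z) (a : y ⟶ z) :
    walkWeight ω (p.comp (invArrowWalk a)) = walkWeight ω p * (ω a)⁻¹ :=
  Path.weight_cons (V := Symmetrify V) _ p (Sum.inr a)

theorem walkWeight_arrowWalk {x y : V} (a : x ⟶ y) : walkWeight ω (arrowWalk a) = ω a :=
  (walkWeight_comp_arrowWalk ω (Path.nil : Walk V x x) a).trans <|
    (congrArg (· * ω a) (walkWeight_nil ω)).trans (one_mul _)

theorem walkWeight_invArrowWalk {x y : V} (a : x ⟶ y) :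
    walkWeight ω (invArrowWalk a) = (ω a)⁻¹ :=
  (walkWeight_comp_invArrowWalk ω (Path.nil : Walk V y y) a).trans <|
    (congrArg (· * (ω a)⁻¹) (walkWeight_nil ω)).trans (one_mul _)

theorem walkWeight_pathWalk {x y : V} (p : Path x y) : walkWeight ω (pathWalk p) = p.weight ω := by
  induction p with
  | nil => exact (walkWeight_nil ω).trans (Path.weight_nil ω x).symm
  | cons p a ih =>
    rw [Path.weight_cons, ← ih]
    exact walkWeight_comp_arrowWalk ω (pathWalk p) a

theorem walk_induction {x : Symmetrify V} {motive : ∀ y : Symmetrify V, Walk V x y → Prop}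
    (nil : motive x Path.nil)
    (comp_arrowWalk : ∀ {y z : V} (p : Walk V x y) (a : y ⟶ z), motive y p →
      motive z (p.comp (arrowWalk a)))
    (comp_invArrowWalk : ∀ {y z : V} (p : Walk V x z) (a : y ⟶ z), motive z p →
      motive y (p.comp (invArrowWalk a))) {y : Symmetrify V} (p : Walk V x y) : motive y p := by
  induction p with
  | nil => exact nil
  | cons p a ih => exact a.rec (comp_arrowWalk p · ih) (comp_invArrowWalk p · ih)

variable {k : Type u} [Field k] [Fintype V] (I : Ideal (PathAlgebra k V))

/-- A weight on the arrows is a grading of the bound quiver if the minimal relations are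
homogeneous. -/
def IsGrading : Prop :=
  ∀ ⦃x y : V⦄ ⦃ρ : Path x y →₀ k⦄, IsMinimalRelation I ρ →
    ∀ p ∈ ρ.support, ∀ q ∈ ρ.support, p.weight ω = q.weight ω

variable {ω I}

theorem Homotopic.walkWeight_eq (hω : IsGrading ω I) {x y : Symmetrify V} {p q : Walk V x y}
    (h : Homotopic I p q) : walkWeight ω p = walkWeight ω q := by
  induction h with
  | refl => rfl
  | symm _ ih => exact ih.symm
  | trans _ _ ih ih' => exact ih.trans ih'
  | arrow_inv a => exact (walkWeight_comp_invArrowWalk ω _ a).trans <|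
      (mul_inv_eq_one.2 (walkWeight_arrowWalk ω a)).trans (walkWeight_nil ω).symm
  | inv_arrow a => exact (walkWeight_comp_arrowWalk ω _ a).trans <|
      (mul_eq_one_iff_eq_inv.2 (walkWeight_invArrowWalk ω a)).trans (walkWeight_nil ω).symm
  | minimal hρ hp hq => rw [walkWeight_pathWalk, walkWeight_pathWalk, hω hρ _ hp _ hq]
  | congr p s _ ih => simp only [walkWeight_comp, ih]

theorem walkWeight_reverse (hω : IsGrading ω I) {x y : Symmetrify V} (p : Walk V x y) :
    walkWeight ω p.reverse = (walkWeight ω p)⁻¹ := by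
  refine eq_inv_of_mul_eq_one_right ?_
  rw [← walkWeight_comp, Homotopic.walkWeight_eq hω (Homotopic.comp_reverse I p).1, walkWeight_nil]

theorem walkWeight_conj (hω : IsGrading ω I) {o x y z : Symmetrify V} {s : Walk V o x}
    {t : Walk V o y} {r : Walk V o z} (hs : walkWeight ω s = 1) (ht : walkWeight ω t = 1)
    (hr : walkWeight ω r = 1) (p : Walk V y z) :
    walkWeight ω ((s.reverse.comp t).comp (p.comp (r.reverse.comp s))) = walkWeight ω p := by
  simp only [walkWeight_comp, walkWeight_reverse hω, hs, ht, hr, inv_one, one_mul, mul_one]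

/-- The morphism from the fundamental group that sends the class of a closed walk to its weight. -/
def weightHom (hω : IsGrading ω I) (x : V) : FundamentalGroup I x →* G where
  toFun := Quotient.lift (walkWeight ω) fun _ _ h => Homotopic.walkWeight_eq hω h
  map_one' := walkWeight_nil ω
  map_mul' := by
    rintro ⟨p⟩ ⟨q⟩
    exact walkWeight_comp ω p q

namespace Homotopic

theorem conj_comp {o x y z : Symmetrify V} (s : Walk V o x) (t : Walk V o y) (r : Walk V o z)
    (p : Walk V x y) (q : Walk V y z) :
    Homotopic I (((s.comp p).comp t.reverse).comp ((t.comp q).comp r.reverse))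
      ((s.comp (p.comp q)).comp r.reverse) := by
  simpa only [Path.comp_assoc, Path.nil_comp] using
    congr (s.comp p) (q.comp r.reverse) (comp_reverse I t).2

theorem reverse_conj {o x y : Symmetrify V} (s : Walk V o x) (t : Walk V o y) (p : Walk V x y) :
    Homotopic I ((s.reverse.comp ((s.comp p).comp t.reverse)).comp t) p := by
  simpa only [Path.comp_assoc, Path.comp_nil, Path.nil_comp] using
    ((comp_reverse I s).2.comp (refl p)).comp (comp_reverse I t).2

theorem of_conj {o x y : Symmetrify V} (s : Walk V o x) (t : Walk V o y) {p q : Walk V x y}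
    (h : Homotopic I ((s.comp p).comp t.reverse) ((s.comp q).comp t.reverse)) : Homotopic I p q :=
  (reverse_conj s t p).symm.trans ((congr s.reverse t h).trans (reverse_conj s t q))

end Homotopic

/-- The class of the closed walk formed by a walk `p` from `x` to `y` and the walks `τ` from the
base point to `x` and `y`. -/
def loopClass (I : Ideal (PathAlgebra k V)) {o : V} (τ : ∀ x : Symmetrify V, Walk V o x)
    {x y : Symmetrify V} (p : Walk V x y) : FundamentalGroup I o :=
  Quotient.mk (homotopySetoid I o) (((τ x).comp p).comp (τ y).reverse)

section LoopClass

variable {o : V} (τ : ∀ x : Symmetrify V, Walk V o x)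

theorem loopClass_nil (x : Symmetrify V) : loopClass I τ (Path.nil : Walk V x x) = 1 :=
  Quotient.sound (Homotopic.comp_reverse I (τ x)).1

theorem loopClass_comp {x y z : Symmetrify V} (p : Walk V x y) (q : Walk V y z) :
    loopClass I τ (p.comp q) = loopClass I τ p * loopClass I τ q :=
  Quotient.sound (Homotopic.conj_comp (τ x) (τ y) (τ z) p q).symm

theorem loopClass_eq_iff {x y : Symmetrify V} {p q : Walk V x y} :
    loopClass I τ p = loopClass I τ q ↔ Homotopic I p q :=
  ⟨fun h => Homotopic.of_conj _ _ (Quotient.exact h),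
    fun h => Quotient.sound (Homotopic.congr _ _ h)⟩

theorem loopClass_invArrowWalk {x y : V} (a : x ⟶ y) :
    loopClass I τ (invArrowWalk a) = (loopClass I τ (arrowWalk a))⁻¹ := by
  refine eq_inv_of_mul_eq_one_left ((loopClass_comp τ _ _).symm.trans ?_)
  exact ((loopClass_eq_iff τ).2 (Homotopic.inv_arrow a)).trans (loopClass_nil τ y)

variable {τ}

theorem map_walkWeight {φ : G →* FundamentalGroup I o}
    (hφ : ∀ {x y : V} (a : x ⟶ y), φ (ω a) = loopClass I τ (arrowWalk a)) {x y : Symmetrify V}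
    (p : Walk V x y) : φ (walkWeight ω p) = loopClass I τ p := by
  induction p using walk_induction with
  | nil => rw [walkWeight_nil, map_one, loopClass_nil]
  | comp_arrowWalk p a ih =>
    refine (congrArg φ (walkWeight_comp_arrowWalk ω p a)).trans ?_
    rw [map_mul, ih, hφ]
    exact (loopClass_comp τ p (arrowWalk a)).symm
  | comp_invArrowWalk p a ih =>
    refine (congrArg φ (walkWeight_comp_invArrowWalk ω p a)).trans ?_
    rw [map_mul, map_inv, ih, hφ, ← loopClass_invArrowWalk]
    exact (loopClass_comp τ p (invArrowWalk a)).symm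

theorem homotopic_of_walkWeight_eq {φ : G →* FundamentalGroup I o}
    (hφ : ∀ {x y : V} (a : x ⟶ y), φ (ω a) = loopClass I τ (arrowWalk a)) {x y : Symmetrify V}
    {p q : Walk V x y} (h : walkWeight ω p = walkWeight ω q) : Homotopic I p q := by
  rw [← loopClass_eq_iff τ, ← map_walkWeight hφ, ← map_walkWeight hφ, h]

theorem weightHom_injective (hω : IsGrading ω I) {φ : G →* FundamentalGroup I o}
    (hφ : ∀ {x y : V} (a : x ⟶ y), φ (ω a) = loopClass I τ (arrowWalk a)) (x : V) :
    Function.Injective (weightHom hω x) := by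
  rintro ⟨p⟩ ⟨q⟩ (h : walkWeight ω p = walkWeight ω q)
  exact Quotient.sound (homotopic_of_walkWeight_eq hφ h)

theorem weightHom_surjective (hω : IsGrading ω I) (hτ : ∀ x, walkWeight ω (τ x) = 1)
    (hgen : Subgroup.closure {g : G | ∃ (x y : V) (a : x ⟶ y), ω a = g} = ⊤) (x : V) :
    Function.Surjective (weightHom hω x) := by
  rw [← MonoidHom.range_eq_top, eq_top_iff, ← hgen, Subgroup.closure_le]
  rintro _ ⟨u, v, a, rfl⟩
  exact ⟨Quotient.mk _ _, (walkWeight_conj hω (hτ x) (hτ u) (hτ v) (arrowWalk a)).trans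
    (walkWeight_arrowWalk ω a)⟩

end LoopClass

end Weight

section MinimalRelation

variable {k : Type u} [Field k] {V : Type v} [Quiver.{w} V] [Fintype V] {x y : V}
  {I : Ideal (PathAlgebra k V)}

theorem IsMinimalRelation.ofParallelPaths_mem {ρ : Path x y →₀ k} (hρ : IsMinimalRelation I ρ) :
    ofParallelPaths k x y ρ ∈ I :=
  hρ.mem

theorem IsMinimalRelation.ofParallelPaths_filter_notMem {ρ : Path x y →₀ k}
    (hρ : IsMinimalRelation I ρ) {s : Path x y → Prop} [DecidablePred s] {p q : Path x y}
    (hp : p ∈ ρ.support) (hq : q ∈ ρ.support) (hsp : s p) (hsq : ¬ s q) :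
    ofParallelPaths k x y (ρ.filter s) ∉ I := by
  have hs := hρ.notMem (ρ.support.filter s) (Finset.filter_ssubset.2 ⟨q, hq, hsq⟩)
    ⟨p, Finset.mem_filter.2 ⟨hp, hsp⟩⟩
  rwa [Finsupp.linearCombination_apply, Finsupp.sum, Finsupp.support_filter,
    Finset.sum_congr rfl fun r hr => by
      rw [Finsupp.filter_apply_pos _ _ (Finset.mem_filter.1 hr).2]]

theorem linearCombination_filter {P D F : Type*} [DecidableEq D] {E : P → F →₀ k} {deg : F → D}
    {degree : P → D} (hdeg : ∀ p, ∀ f ∈ (E p).support, deg f = degree p) (d : D) (c : P →₀ k) :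
    Finsupp.linearCombination k E (c.filter (degree · = d)) =
      (Finsupp.linearCombination k E c).filter (deg · = d) := by
  induction c using Finsupp.induction_linear with
  | zero => simp only [Finsupp.filter_zero, map_zero]
  | add c c' hc hc' => simp only [Finsupp.filter_add, map_add, hc, hc']
  | single p r =>
    rw [Finsupp.linearCombination_single, Finsupp.filter_smul]
    by_cases h : degree p = d
    · rw [Finsupp.filter_single_of_pos (degree · = d) h, Finsupp.linearCombination_single]
      refine congrArg (r • ·) (Finsupp.filter_eq_self_iff _ _ |>.2 fun f hf => ?_).symm
      exact (hdeg p f (Finsupp.mem_support_iff.2 hf)).trans h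
    · rw [Finsupp.filter_single_of_neg (degree · = d) h, map_zero]
      refine (smul_eq_zero_of_right r (Finsupp.filter_eq_zero_iff _ _ |>.2 fun f hf => ?_)).symm
      exact Finsupp.notMem_support_iff.1 fun hfE => h ((hdeg p f hfE).symm.trans hf)

theorem IsMinimalRelation.degree_eq {D F : Type*} {E : Path x y → F →₀ k}
    (hE : ∀ c, ofParallelPaths k x y c ∈ I ↔ Finsupp.linearCombination k E c = 0) {deg : F → D}
    {degree : Path x y → D} (hdeg : ∀ p, ∀ f ∈ (E p).support, deg f = degree p)
    {ρ : Path x y →₀ k} (hρ : IsMinimalRelation I ρ) {p q : Path x y}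
    (hp : p ∈ ρ.support) (hq : q ∈ ρ.support) : degree p = degree q := by
  classical
  by_contra hne
  refine hρ.ofParallelPaths_filter_notMem (s := (degree · = degree p)) hp hq rfl (Ne.symm hne) ?_
  rw [hE, linearCombination_filter hdeg, (hE ρ).1 hρ.mem, Finsupp.filter_zero]

theorem exists_mem_support_of_ofParallelPaths_mem {ρ : Path x y →₀ k}
    (hρ : ofParallelPaths k x y ρ ∈ I) {p : Path x y} (hp : p ∈ ρ.support) :
    ∃ c : Path x y →₀ k, c.support ⊆ ρ.support ∧ p ∈ c.support ∧ ofParallelPaths k x y c ∈ I ∧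
      ∀ J ⊂ c.support, J.Nonempty → ∑ r ∈ J, c r • ofPath k r ∉ I := by
  classical
  obtain ⟨c, ⟨hcρ, hpc, hcI⟩, hc⟩ := exists_minimalFor_of_wellFoundedLT
    (fun c : Path x y →₀ k => c.support ⊆ ρ.support ∧ p ∈ c.support ∧ ofParallelPaths k x y c ∈ I)
    Finsupp.support ⟨ρ, subset_rfl, hp, hρ⟩
  refine ⟨c, hcρ, hpc, hcI, fun J hJ ⟨q, hq⟩ hJI => ?_⟩
  have forall_of_filter_mem {s : Path x y → Prop} [DecidablePred s] (hs : s p)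
      (hI : ofParallelPaths k x y (c.filter s) ∈ I) : ∀ r ∈ c.support, s r := by
    have hcs := @hc (c.filter s)
    rw [Finsupp.support_filter] at hcs
    refine fun r hr => (Finset.mem_filter.1 (hcs ⟨?_, Finset.mem_filter.2 ⟨hpc, hs⟩, hI⟩ ?_ hr)).2
    exacts [(Finset.filter_subset s _).trans hcρ, Finset.filter_subset s _]
  have filter_mem : ofParallelPaths k x y (c.filter (· ∈ J)) ∈ I := by
    rwa [Finsupp.linearCombination_apply, Finsupp.sum, Finsupp.support_filter,
      Finset.filter_mem_eq_inter, Finset.inter_eq_right.2 hJ.le,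
      Finset.sum_congr rfl fun r hr => by rw [Finsupp.filter_apply_pos _ _ hr]]
  by_cases hpJ : p ∈ J
  · exact hJ.not_subset (forall_of_filter_mem hpJ filter_mem)
  · have filter_not_mem : ofParallelPaths k x y (c.filter (· ∉ J)) ∈ I := by
      rwa [← Ideal.add_mem_iff_right I filter_mem, ← map_add, Finsupp.filter_add_filter_not]
    exact forall_of_filter_mem hpJ filter_not_mem q (hJ.subset hq) hq

theorem homotopic_of_ofParallelPaths_mem {ρ : Path x y →₀ k} (hρ : ofParallelPaths k x y ρ ∈ I)
    {f : Path x y → k} (hf : ∀ c, ofParallelPaths k x y c ∈ I → Finsupp.linearCombination k f c = 0)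
    {p q : Path x y} (hp : p ∈ ρ.support) (hfp : f p ≠ 0)
    (hfr : ∀ r ∈ ρ.support, r ≠ p → r ≠ q → f r = 0) : Homotopic I (pathWalk p) (pathWalk q) := by
  obtain rfl | hpq := eq_or_ne p q
  · exact Homotopic.refl _
  obtain ⟨c, hcρ, hpc, hcI, hc⟩ := exists_mem_support_of_ofParallelPaths_mem hρ hp
  have hqc : q ∈ c.support := by
    by_contra hqc
    have sum_eq : Finsupp.linearCombination k f c = c p • f p := by
      rw [Finsupp.linearCombination_apply]
      refine Finset.sum_eq_single_of_mem p hpc fun r hr hrp => ?_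
      exact smul_eq_zero_of_right _ (hfr r (hcρ hr) hrp (ne_of_mem_of_not_mem hr hqc))
    rw [hf c hcI, eq_comm, smul_eq_zero] at sum_eq
    exact sum_eq.elim (Finsupp.mem_support_iff.1 hpc) hfp
  exact Homotopic.minimal ⟨hcI, Finset.one_lt_card.2 ⟨p, hpc, q, hqc, hpq⟩, hc⟩ hpc hqc

end MinimalRelation

/-! ## Two-step quivers -/

/-- The vertices of the quiver `source ⟶ middle ⟶ target` whose arrows from the source to the middle
are labelled by `F` and whose arrows from the middle to the target are labelled by `S`. -/
inductive TwoStepQuiver (F S : Type*) : Type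
  | source | middle | target

namespace TwoStepQuiver

variable {F S : Type*}

/-- The arrows of `TwoStepQuiver F S`. -/
inductive Arrow : TwoStepQuiver F S → TwoStepQuiver F S → Type _
  | first (f : F) : Arrow source middle
  | second (s : S) : Arrow middle target

instance : Quiver (TwoStepQuiver F S) := ⟨Arrow⟩

instance : Fintype (TwoStepQuiver F S) where
  elems := ⟨([source, middle, target] : List (TwoStepQuiver F S)), by simp⟩
  complete x := by cases x <;> simp

/-- The arrow from the source to the middle with label `f`. -/
def first (f : F) : (source : TwoStepQuiver F S) ⟶ middle := Arrow.first f

/-- The arrow from the middle to the target with label `s`. -/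
def second (s : S) : (middle : TwoStepQuiver F S) ⟶ target := Arrow.second s

/-- The path from the source to the target formed by the arrows with labels `f` and `s`. -/
def twoPath (f : F) (s : S) : Path (source : TwoStepQuiver F S) target :=
  (first f).toPath.cons (second s)

theorem isEmpty_hom_source (x : TwoStepQuiver F S) : IsEmpty (x ⟶ source) :=
  ⟨fun a => by rcases a⟩

theorem isEmpty_target_hom (x : TwoStepQuiver F S) : IsEmpty (target ⟶ x) :=
  ⟨fun a => by rcases a⟩

@[elab_as_elim]
theorem path_cases {motive : ∀ {x y : TwoStepQuiver F S}, Path x y → Prop}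
    (nil : ∀ x : TwoStepQuiver F S, motive (Path.nil : Quiver.Path x x))
    (first : ∀ f, motive (first f).toPath) (second : ∀ s, motive (second s).toPath)
    (twoPath : ∀ f s, motive (twoPath f s)) {x y : TwoStepQuiver F S} (p : Path x y) :
    motive p := by
  rcases p with _ | ⟨p, f | s⟩
  · exact nil _
  · rcases p with _ | ⟨p, ⟨⟩⟩
    exact first f
  · rcases p with _ | ⟨p, f | _⟩
    · exact second s
    · rcases p with _ | ⟨p, ⟨⟩⟩
      exact twoPath f s

theorem length_lt {x y : TwoStepQuiver F S} (p : Path x y) : p.length < 3 := by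
  induction p using path_cases with
  | nil _ => exact Nat.zero_lt_succ 2
  | first _ => exact Nat.one_lt_succ_succ 1
  | second _ => exact Nat.one_lt_succ_succ 1
  | twoPath _ _ => exact Nat.lt_succ_self 2

theorem isAcyclicQuiver : IsAcyclicQuiver (TwoStepQuiver F S) := by
  have eq_nil {x y : TwoStepQuiver F S} (p : Path x y) (h : x = y) :
      p = Path.nil.cast rfl h := by
    induction p using path_cases with
    | nil x => rfl
    | _ => cases h
  exact fun x p => eq_nil p rfl

variable (F S) in
/-- The paths from the source to the target are given by the labels of their two arrows. -/
def pathEquiv : F × S ≃ Path (source : TwoStepQuiver F S) target :=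
  Equiv.ofBijective (fun a => twoPath a.1 a.2) <| by
    refine ⟨fun ⟨f, s⟩ ⟨f', s'⟩ h => ?_, fun p => ?_⟩
    · obtain ⟨-, hf, hs⟩ := Path.cons.inj h
      obtain ⟨-, -, hf⟩ := Path.cons.inj (eq_of_heq hf)
      exact Prod.ext (Arrow.first.inj (eq_of_heq hf)) (Arrow.second.inj (eq_of_heq hs))
    · rcases p with _ | ⟨p, _ | s⟩
      rcases p with _ | ⟨p, f | _⟩
      rcases p with _ | ⟨p, ⟨⟩⟩
      exact ⟨(f, s), rfl⟩

theorem pathEquiv_apply (f : F) (s : S) : pathEquiv F S (f, s) = twoPath f s :=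
  rfl

theorem pathEquiv_symm_twoPath (f : F) (s : S) : (pathEquiv F S).symm (twoPath f s) = (f, s) :=
  (pathEquiv F S).symm_apply_apply (f, s)

instance [Finite F] [Finite S] (x y : TwoStepQuiver F S) : Finite (x ⟶ y) := by
  cases x <;> cases y
  case source.middle => exact Finite.of_surjective first fun | Arrow.first f => ⟨f, rfl⟩
  case middle.target => exact Finite.of_surjective second fun | Arrow.second s => ⟨s, rfl⟩
  all_goals exact @Finite.of_subsingleton _ ⟨fun a => by rcases a⟩

/-- The walk from the source to a vertex through the arrows with labels `f` and `s`. -/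
def baseWalk (f : F) (s : S) : ∀ x : Symmetrify (TwoStepQuiver F S), Walk _ source x
  | source => Path.nil
  | middle => arrowWalk (first f)
  | target => (arrowWalk (first f)).comp (arrowWalk (second s))

theorem twoPath_inj {f f' : F} {c c' : S} :
    twoPath f c = twoPath f' c' ↔ f = f' ∧ c = c' :=
  (pathEquiv F S).injective.eq_iff.trans Prod.mk_inj

theorem weight_twoPath {G : Type*} [Monoid G]
    (ω : ∀ {x y : TwoStepQuiver F S}, (x ⟶ y) → G) (f : F) (s : S) :
    (twoPath f s).weight ω = ω (first f) * ω (second s) := by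
  simp only [twoPath, Hom.toPath, Path.weight_cons, Path.weight_nil, one_mul]

theorem isConnectedQuiver [Nonempty F] [Nonempty S] : IsConnectedQuiver (TwoStepQuiver F S) := by
  let τ := baseWalk (Classical.arbitrary F) (Classical.arbitrary S)
  exact ⟨⟨source⟩, fun x y => ⟨(τ x).reverse.comp (τ y)⟩⟩

section LoopClass

variable {k : Type u} [Field k] {I : Ideal (PathAlgebra k (TwoStepQuiver F S))}

theorem loopClass_twoPath {o : TwoStepQuiver F S}
    (τ : ∀ x : Symmetrify (TwoStepQuiver F S), Walk _ o x) (f : F) (s : S) :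
    loopClass I τ (pathWalk (twoPath f s)) =
      loopClass I τ (arrowWalk (first f)) * loopClass I τ (arrowWalk (second s)) :=
  loopClass_comp τ (arrowWalk (first f)) (arrowWalk (second s))

theorem loopClass_baseWalk_first (f : F) (s : S) :
    loopClass I (baseWalk f s) (arrowWalk (first f)) = 1 :=
  (congrArg (Quotient.mk _) (congrArg (Path.comp · _) (Path.nil_comp _))).trans <|
    Quotient.sound (Homotopic.comp_reverse I _).1

theorem loopClass_baseWalk_second (f : F) (s : S) :
    loopClass I (baseWalk f s) (arrowWalk (second s)) = 1 :=
  Quotient.sound (Homotopic.comp_reverse I _).1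

end LoopClass

section Substitution

variable {k : Type u} [Field k]

/-- The inclusion in `kQ` of the linear combinations of arrows from the source to the middle. -/
def ofFirst (k : Type u) [Field k] (F S : Type*) :
    (F →₀ k) →ₗ[k] PathAlgebra k (TwoStepQuiver F S) :=
  Finsupp.linearCombination k fun f => ofPath k (first f).toPath

theorem ofFirst_mul_ofPath_second (c : F →₀ k) (s : S) :
    ofFirst k F S c * ofPath k (second s).toPath =
      ofParallelPaths k source target (c.mapDomain (twoPath · s)) := by
  rw [Finsupp.linearCombination_mapDomain]
  simp only [ofFirst, Finsupp.linearCombination_apply, Finsupp.sum, Finset.sum_mul,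
    smul_mul_assoc, ofPath_mul_ofPath]
  rfl

theorem ofFirst_mul_ofPath_nil (c : F →₀ k) :
    ofFirst k F S c * ofPath k (Path.nil : Path (middle : TwoStepQuiver F S) middle) =
      ofFirst k F S c := by
  simp only [ofFirst, Finsupp.linearCombination_apply, Finsupp.sum, Finset.sum_mul,
    smul_mul_assoc, ofPath_mul_ofPath, Path.comp_nil]

theorem ofPath_nil_mul_ofFirst (c : F →₀ k) :
    ofPath k (Path.nil : Path (source : TwoStepQuiver F S) source) * ofFirst k F S c =
      ofFirst k F S c := by
  simp only [ofFirst, Finsupp.linearCombination_apply, Finsupp.sum, Finset.mul_sum,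
    mul_smul_comm, ofPath_mul_ofPath, Path.nil_comp]

/-- The image of an arrow under `firstSubst`. -/
def arrowSubst (v : F → F →₀ k) : ∀ {x y : TwoStepQuiver F S}, (x ⟶ y) →
    PathAlgebra k (TwoStepQuiver F S)
  | _, _, .first f => ofFirst k F S (v f)
  | _, _, .second s => ofPath k (second s).toPath

theorem arrowSubst_mul_ofPath_nil (v : F → F →₀ k) {x y : TwoStepQuiver F S} (a : x ⟶ y) :
    arrowSubst v a * ofPath k (Path.nil : Path y y) = arrowSubst v a := by
  rcases a with f | s
  · exact ofFirst_mul_ofPath_nil (v f)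
  · exact ofPath_mul_ofPath (second s).toPath Path.nil

/-- The endomorphism of `kQ` that replaces the arrow from the source to the middle with label `f` by
the linear combination `v f` of such arrows. -/
def firstSubst (S : Type*) (v : F → F →₀ k) :
    PathAlgebra k (TwoStepQuiver F S) →ₐ[k] PathAlgebra k (TwoStepQuiver F S) :=
  PathAlgebra.lift k (fun x => ofPath k (Path.nil : Path x x)) (arrowSubst v)
    (completeOrthogonalIdempotents_ofPath_nil k _) (arrowSubst_mul_ofPath_nil v)

theorem ofPath_twoPath (f : F) (s : S) :
    ofPath k (twoPath f s) = ofPath k (first f).toPath * ofPath k (second s).toPath :=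
  (ofPath_mul_ofPath (first f).toPath (second s).toPath).symm

variable {v w : F → F →₀ k}

theorem firstSubst_ofPath_nil (x : TwoStepQuiver F S) :
    firstSubst S v (ofPath k (Path.nil : Path x x)) = ofPath k (Path.nil : Path x x) :=
  lift_ofPath_nil _ (arrowSubst_mul_ofPath_nil v) x

theorem firstSubst_ofPath_first (f : F) :
    firstSubst S v (ofPath k (first f).toPath) = ofFirst k F S (v f) :=
  (lift_ofPath_toPath _ (arrowSubst_mul_ofPath_nil v) (first f)).trans (ofPath_nil_mul_ofFirst _)

theorem firstSubst_ofPath_second (s : S) :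
    firstSubst S v (ofPath k (second s : (middle : TwoStepQuiver F S) ⟶ target).toPath) =
      ofPath k (second s).toPath :=
  (lift_ofPath_toPath _ (arrowSubst_mul_ofPath_nil v) (second s)).trans (ofPath_mul_ofPath _ _)

theorem firstSubst_ofPath_twoPath (f : F) (s : S) :
    firstSubst S v (ofPath k (twoPath f s)) =
      ofParallelPaths k source target ((v f).mapDomain (twoPath · s)) := by
  rw [ofPath_twoPath, map_mul, firstSubst_ofPath_first, firstSubst_ofPath_second,
    ofFirst_mul_ofPath_second]

theorem firstSubst_ofFirst (c : F →₀ k) :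
    firstSubst S v (ofFirst k F S c) = ofFirst k F S (Finsupp.linearCombination k v c) := by
  suffices (firstSubst S v).toLinearMap ∘ₗ ofFirst k F S =
      ofFirst k F S ∘ₗ Finsupp.linearCombination k v from LinearMap.congr_fun this c
  refine Finsupp.lhom_ext' fun f => LinearMap.ext_ring ?_
  simpa [ofFirst] using firstSubst_ofPath_first f

theorem firstSubst_comp_firstSubst (hvw : ∀ f, Finsupp.linearCombination k v (w f) = .single f 1) :
    (firstSubst S v).comp (firstSubst S w) = AlgHom.id k _ := by
  refine algHom_ext (fun x => ?_) fun {_ _} a => ?_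
  · simp only [AlgHom.comp_apply, firstSubst_ofPath_nil, AlgHom.id_apply]
  · rcases a with f | s
    · refine (congrArg (firstSubst S v) (firstSubst_ofPath_first f)).trans ?_
      rw [firstSubst_ofFirst, hvw, ofFirst, Finsupp.linearCombination_single, one_smul]
      rfl
    · exact (congrArg (firstSubst S v) (firstSubst_ofPath_second s)).trans
        (firstSubst_ofPath_second s)

/-- The action of `firstSubst S v` on the linear combinations of paths from the source to the
target. -/
def pathSubst (S : Type*) (v : F → F →₀ k) :
    (Path (source : TwoStepQuiver F S) target →₀ k) →ₗ[k]
      (Path (source : TwoStepQuiver F S) target →₀ k) :=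
  Finsupp.linearCombination k fun p =>
    (v ((pathEquiv F S).symm p).1).mapDomain (twoPath · ((pathEquiv F S).symm p).2)

theorem firstSubst_ofParallelPaths (c : Path (source : TwoStepQuiver F S) target →₀ k) :
    firstSubst S v (ofParallelPaths k source target c) =
      ofParallelPaths k source target (pathSubst S v c) := by
  suffices (firstSubst S v).toLinearMap ∘ₗ ofParallelPaths k source target =
      ofParallelPaths k source target ∘ₗ pathSubst S v from LinearMap.congr_fun this c
  refine Finsupp.lhom_ext' fun p => LinearMap.ext_ring ?_
  obtain ⟨⟨f, s⟩, rfl⟩ := (pathEquiv F S).surjective p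
  simp [pathSubst, pathEquiv_apply, pathEquiv_symm_twoPath, firstSubst_ofPath_twoPath]

theorem linearCombination_pathSubst {N : Type*} [AddCommGroup N] [Module k N] (E : F × S → N)
    (c : Path (source : TwoStepQuiver F S) target →₀ k) :
    Finsupp.linearCombination k (E ∘ (pathEquiv F S).symm) (pathSubst S v c) =
      Finsupp.linearCombination k ((fun a : F × S =>
        Finsupp.linearCombination k (fun f => E (f, a.2)) (v a.1)) ∘ (pathEquiv F S).symm) c := by
  suffices Finsupp.linearCombination k (E ∘ (pathEquiv F S).symm) ∘ₗ pathSubst S v =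
      Finsupp.linearCombination k ((fun a : F × S =>
        Finsupp.linearCombination k (fun f => E (f, a.2)) (v a.1)) ∘ (pathEquiv F S).symm) from
    LinearMap.congr_fun this c
  refine Finsupp.lhom_ext' fun p => LinearMap.ext_ring ?_
  simp [pathSubst, Finsupp.linearCombination_mapDomain, Function.comp_def, pathEquiv_symm_twoPath]

theorem firstSubst_mem_relationIdeal (hwv : ∀ f, Finsupp.linearCombination k w (v f) = .single f 1)
    {W : Submodule k (Path (source : TwoStepQuiver F S) target →₀ k)}
    {a : PathAlgebra k (TwoStepQuiver F S)} :
    firstSubst S v a ∈ relationIdeal isEmpty_hom_source W ↔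
      a ∈ relationIdeal isEmpty_hom_source (W.comap (pathSubst S v)) := by
  constructor
  · intro ha
    obtain ⟨c, hc, hca⟩ := mem_relationIdeal.1 ha
    have a_eq : ofParallelPaths k source target (pathSubst S w c) = a := by
      rw [← firstSubst_ofParallelPaths, hca]
      exact AlgHom.congr_fun (firstSubst_comp_firstSubst hwv) a
    refine mem_relationIdeal.2 ⟨_, ?_, a_eq⟩
    rw [Submodule.mem_comap]
    rwa [ofParallelPaths_injective (hca.trans <|
      (congrArg _ a_eq.symm).trans (firstSubst_ofParallelPaths _))] at hc
  · rintro ⟨c, hc, rfl⟩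
    exact mem_relationIdeal.2 ⟨_, hc, (firstSubst_ofParallelPaths c).symm⟩

end Substitution

section PathIdeal

variable {k : Type u} [Field k]

theorem ofParallelPaths_mem_arrowIdeal_sq
    (c : Path (source : TwoStepQuiver F S) target →₀ k) :
    ofParallelPaths k source target c ∈ arrowIdeal k (TwoStepQuiver F S) ^ 2 := by
  refine Submodule.sum_mem _ fun p _ => Submodule.smul_of_tower_mem _ (c p) ?_
  obtain ⟨⟨f, s⟩, rfl⟩ := (pathEquiv F S).surjective p
  rw [pathEquiv_apply, ofPath_twoPath, Submodule.pow_succ, Submodule.pow_one]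
  exact Submodule.mul_mem_mul (ofPath_toPath_mem_arrowIdeal _) (ofPath_toPath_mem_arrowIdeal _)

theorem isAdmissible_relationIdeal
    (W : Submodule k (Path (source : TwoStepQuiver F S) target →₀ k)) :
    IsAdmissible (relationIdeal isEmpty_hom_source W) where
  isTwoSided := isTwoSided_relationIdeal _ isEmpty_target_hom W
  exists_pow_le := ⟨3, Nat.le_succ 2, by
    rw [arrowIdeal_pow_eq_bot length_lt]
    exact bot_le⟩
  le_sq := by
    rintro _ ⟨c, -, rfl⟩
    exact ofParallelPaths_mem_arrowIdeal_sq c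

end PathIdeal

end TwoStepQuiver

/-! ## The quiver of a multiplication table -/

section TableQuiver

open TwoStepQuiver

/-- The quiver attached to a multiplication table on `T`: the arrows from the middle to the target
are labelled by the elements of `T` and a unit, the arrows from the source to the middle by the
elements of `T` and by the triples, a triple `(s, t, r)` being a possible entry `s * t = r` of the
table. -/
abbrev TableQuiver (T : Type v) : Type :=
  TwoStepQuiver (T ⊕ T × T × T) (Option T)

variable {k : Type u} [Field k] {T : Type v}

open Classical in
/-- The coordinates of the path with labels `a` with respect to the paths labelled by
`T × Option T`, modulo the relations `(s, t, r) · t = ε (s, t, r) • s · t + r · 1`, and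
`(s, t, r) · c = ε (s, t, r) • s · c` for `c ≠ t`, where `none` is the label `1`. -/
def tableCoord (ε : T × T × T → k) : (T ⊕ T × T × T) × Option T → (T × Option T →₀ k)
  | (.inl s, c) => .single (s, c) 1
  | (.inr h, c) => .single (h.1, c) (ε h) + if c = some h.2.1 then .single (h.2.2, none) 1 else 0

/-- The ideal generated by the relations that define `tableCoord ε`. -/
def tableIdeal (ε : T × T × T → k) : Ideal (PathAlgebra k (TableQuiver T)) :=
  relationIdeal isEmpty_hom_source
    (LinearMap.ker (Finsupp.linearCombination k (tableCoord ε ∘ (pathEquiv _ _).symm)))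

theorem ofParallelPaths_mem_tableIdeal (ε : T × T × T → k)
    {c : Path (source : TableQuiver T) target →₀ k} :
    ofParallelPaths k source target c ∈ tableIdeal ε ↔
      Finsupp.linearCombination k (tableCoord ε ∘ (pathEquiv _ _).symm) c = 0 := by
  rw [tableIdeal, mem_relationIdeal, ← LinearMap.mem_ker]
  constructor
  · rintro ⟨c', hc', h⟩
    rwa [← ofParallelPaths_injective h]
  · exact fun hc => ⟨c, hc, rfl⟩

instance isTwoSided_tableIdeal (ε : T × T × T → k) : (tableIdeal ε).IsTwoSided :=
  isTwoSided_relationIdeal _ isEmpty_target_hom _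

/-- The substitution that adds `ε (s, t, r)` times the arrow `s` to the arrow `(s, t, r)`. -/
def transvection (ε : T × T × T → k) : T ⊕ T × T × T → (T ⊕ T × T × T →₀ k)
  | .inl s => .single (.inl s) 1
  | .inr h => .single (.inr h) 1 + .single (.inl h.1) (ε h)

theorem linearCombination_transvection_neg (ε : T × T × T → k) (f : T ⊕ T × T × T) :
    Finsupp.linearCombination k (transvection (-ε)) (transvection ε f) = .single f 1 := by
  cases f <;> simp [transvection, add_assoc]

theorem tableCoord_eq_linearCombination (ε : T × T × T → k) (a : (T ⊕ T × T × T) × Option T) :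
    tableCoord ε a =
      Finsupp.linearCombination k (fun f => tableCoord 0 (f, a.2)) (transvection ε a.1) := by
  obtain ⟨_ | h, c⟩ := a <;> simp [transvection, tableCoord, add_comm]

variable (k T) in
/-- The algebra of the quiver `TableQuiver T` that is presented by every ideal `tableIdeal ε`. -/
abbrev TableAlgebra : Type (max u v) :=
  PathAlgebra k (TableQuiver T) ⧸ tableIdeal (0 : T × T × T → k)

/-- The presentation of `TableAlgebra k T` twisted by a transvection. -/
def tablePresentation (ε : T × T × T → k) :
    PathAlgebra k (TableQuiver T) →ₐ[k] TableAlgebra k T :=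
  (Ideal.Quotient.mkₐ k (tableIdeal (0 : T × T × T → k))).comp (firstSubst _ (transvection ε))

theorem ker_tablePresentation (ε : T × T × T → k) :
    RingHom.ker (tablePresentation ε) = tableIdeal ε := by
  ext a
  have mem_ker : a ∈ RingHom.ker (tablePresentation ε) ↔
      firstSubst _ (transvection ε) a ∈ tableIdeal (0 : T × T × T → k) :=
    Ideal.Quotient.eq_zero_iff_mem
  rw [mem_ker, tableIdeal, firstSubst_mem_relationIdeal (linearCombination_transvection_neg ε),
    tableIdeal]
  congr! 2
  ext c
  rw [Submodule.mem_comap, LinearMap.mem_ker, linearCombination_pathSubst, LinearMap.mem_ker,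
    funext (tableCoord_eq_linearCombination ε)]

theorem tablePresentation_surjective (ε : T × T × T → k) :
    Function.Surjective (tablePresentation ε) := by
  have comp_eq_id := firstSubst_comp_firstSubst (S := Option T) fun f =>
    (congrArg (fun δ => Finsupp.linearCombination k (transvection δ) (transvection (-ε) f))
      (neg_neg ε).symm).trans (linearCombination_transvection_neg (-ε) f)
  have surjective : Function.Surjective (firstSubst (Option T) (transvection ε)) :=
    fun a => ⟨_, AlgHom.congr_fun comp_eq_id a⟩
  exact (Ideal.Quotient.mkₐ_surjective k _).comp surjective

theorem isPresentation_tablePresentation [Finite T] [Nonempty T] (ε : T × T × T → k) :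
    IsPresentation (tablePresentation ε) where
  finite_arrows _ _ := inferInstance
  connected := isConnectedQuiver
  surjective := tablePresentation_surjective ε
  admissible := by
    rw [ker_tablePresentation]
    exact isAdmissible_relationIdeal _

theorem isTriangularAlgebra_tableAlgebra (k : Type u) [Field k] (T : Type) [Finite T] [Nonempty T] :
    IsTriangularAlgebra k (TableAlgebra k T) :=
  ⟨TableQuiver T, _, _, tablePresentation 0, isAcyclicQuiver, isPresentation_tablePresentation 0⟩

end TableQuiver

section TableHomotopy

open TwoStepQuiver

variable {k : Type u} [Field k] {T : Type v}

section Grading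

variable {M : Type*} [Group M]

/-- The weights on the arrows of `TableQuiver T` for which the arrows labelled by `t : T` have
weight `σ t` and the relations of a multiplication table satisfied by `σ` are homogeneous. -/
def tableWeight (σ : T → M) : ∀ {x y : TableQuiver T}, (x ⟶ y) → M
  | _, _, .first (.inl s) => σ s
  | _, _, .first (.inr h) => σ h.2.2 * (σ h.2.1)⁻¹
  | _, _, .second c => c.elim 1 σ

variable {σ : T → M} {ε : T × T × T → k}

theorem weight_of_mem_support_tableCoord (hε : ∀ s t r, ε (s, t, r) ≠ 0 → σ s * σ t = σ r)
    {p : Path (source : TableQuiver T) target} {a : T × Option T}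
    (ha : a ∈ (tableCoord ε ((pathEquiv _ _).symm p)).support) :
    σ a.1 * a.2.elim 1 σ = p.weight (tableWeight σ) := by
  classical
  obtain ⟨⟨f, c⟩, rfl⟩ := (pathEquiv _ _).surjective p
  rw [pathEquiv_apply, weight_twoPath]
  rw [Equiv.symm_apply_apply] at ha
  change _ = tableWeight σ (first f) * c.elim 1 σ
  obtain s | ⟨s, t, r⟩ := f
  · obtain rfl := Finset.mem_singleton.1 (Finsupp.support_single_subset ha)
    rfl
  · change _ = σ r * (σ t)⁻¹ * c.elim 1 σ
    obtain h | h := Finset.mem_union.1 (Finsupp.support_add ha)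
    · have ne : ε (s, t, r) ≠ 0 := fun h0 => by simp [h0] at h
      obtain rfl := Finset.mem_singleton.1 (Finsupp.support_single_subset h)
      rw [← hε s t r ne, mul_inv_cancel_right]
    · split_ifs at h with hc
      · obtain rfl := Finset.mem_singleton.1 (Finsupp.support_single_subset h)
        simp [hc]
      · simp at h

theorem isGrading_tableWeight (hε : ∀ s t r, ε (s, t, r) ≠ 0 → σ s * σ t = σ r) :
    IsGrading (tableWeight σ) (tableIdeal ε) := by
  intro x y ρ hρ p hp q hq
  by_cases hxy : x = source ∧ y = target
  · obtain ⟨rfl, rfl⟩ := hxy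
    exact hρ.degree_eq (fun _ => ofParallelPaths_mem_tableIdeal ε)
      (fun _ _ => weight_of_mem_support_tableCoord hε) hp hq
  · obtain ⟨c, -, hc⟩ := mem_relationIdeal.1 hρ.ofParallelPaths_mem
    have ρ_eq_zero := eq_zero_of_ofParallelPaths_eq hc.symm (not_and_or.1 hxy)
    simp [ρ_eq_zero] at hp

end Grading

section Homotopy

variable (ε : T × T × T → k) (s t r : T)

/-- The relation `(s, t, r) · t = ε (s, t, r) • s · t + r · 1`. -/
def tableRelation : Path (source : TableQuiver T) target →₀ k :=
  .single (twoPath (.inr (s, t, r)) (some t)) 1 -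
    .single (twoPath (.inl s) (some t)) (ε (s, t, r)) - .single (twoPath (.inl r) none) 1

theorem ofParallelPaths_tableRelation_mem :
    ofParallelPaths k source target (tableRelation ε s t r) ∈ tableIdeal ε := by
  rw [ofParallelPaths_mem_tableIdeal]
  simp [tableRelation, pathEquiv_symm_twoPath, tableCoord]

theorem twoPath_mem_support_tableRelation :
    twoPath (.inr (s, t, r)) (some t) ∈ (tableRelation ε s t r).support := by
  simp [tableRelation, twoPath_inj]

theorem eq_of_mem_support_tableRelation {q : Path (source : TableQuiver T) target}
    (hq : q ∈ (tableRelation ε s t r).support) :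
    q = twoPath (.inr (s, t, r)) (some t) ∨ q = twoPath (.inl s) (some t) ∨
      q = twoPath (.inl r) none := by
  by_contra! h
  exact Finsupp.mem_support_iff.1 hq
    (by simp [tableRelation, h.1.symm, h.2.1.symm, h.2.2.symm])

theorem linearCombination_tableCoord_apply (a : T × Option T)
    {c : Path (source : TableQuiver T) target →₀ k}
    (hc : ofParallelPaths k source target c ∈ tableIdeal ε) :
    Finsupp.linearCombination k (fun p => tableCoord ε ((pathEquiv _ _).symm p) a) c = 0 := by
  have h := congrArg (Finsupp.lapply (R := k) a) ((ofParallelPaths_mem_tableIdeal ε).1 hc)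
  rwa [map_zero, Finsupp.apply_linearCombination] at h

theorem homotopic_twoPath_none : Homotopic (tableIdeal ε)
    (pathWalk (twoPath (.inr (s, t, r)) (some t))) (pathWalk (twoPath (.inl r) none)) := by
  refine homotopic_of_ofParallelPaths_mem (ofParallelPaths_tableRelation_mem ε s t r)
    (fun _ => linearCombination_tableCoord_apply ε (r, none))
    (twoPath_mem_support_tableRelation ε s t r) ?_ fun p hp hne hne' => ?_
  · simp [pathEquiv_symm_twoPath, tableCoord]
  · obtain rfl := ((eq_of_mem_support_tableRelation ε s t r hp).resolve_left hne).resolve_right hne'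
    simp [pathEquiv_symm_twoPath, tableCoord]

variable {ε s t r}

theorem homotopic_twoPath_some (hε : ε (s, t, r) ≠ 0) : Homotopic (tableIdeal ε)
    (pathWalk (twoPath (.inr (s, t, r)) (some t))) (pathWalk (twoPath (.inl s) (some t))) := by
  refine homotopic_of_ofParallelPaths_mem (ofParallelPaths_tableRelation_mem ε s t r)
    (fun _ => linearCombination_tableCoord_apply ε (s, some t))
    (twoPath_mem_support_tableRelation ε s t r) ?_ fun p hp hne hne' => ?_
  · simpa [pathEquiv_symm_twoPath, tableCoord] using hε
  · obtain rfl := ((eq_of_mem_support_tableRelation ε s t r hp).resolve_left hne).resolve_left hne'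
    simp [pathEquiv_symm_twoPath, tableCoord]

end Homotopy

section FundamentalGroup

variable {M : Type*} [Group M] {σ : T → M} {ε : T × T × T → k}

theorem walkWeight_baseWalk {o : T} (ho : σ o = 1) (x : Symmetrify (TableQuiver T)) :
    walkWeight (tableWeight σ) (baseWalk (.inl o) none x) = 1 := by
  have weight_first : walkWeight (tableWeight σ) (arrowWalk (first (.inl o))) = 1 :=
    (walkWeight_arrowWalk _ _).trans ho
  cases x with
  | source => exact walkWeight_nil _
  | middle => exact weight_first
  | target => exact (walkWeight_comp_arrowWalk _ _ _).trans <|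
      (mul_one _).trans weight_first

theorem closure_range_tableWeight (hσ : Subgroup.closure (Set.range σ) = ⊤) :
    Subgroup.closure {g | ∃ (x y : TableQuiver T) (a : x ⟶ y), tableWeight σ a = g} = ⊤ := by
  rw [eq_top_iff, ← hσ]
  exact Subgroup.closure_mono (Set.range_subset_iff.2 fun t => ⟨_, _, first (.inl t), rfl⟩)

variable (ε) in
theorem loopClass_first_inr {o : TableQuiver T}
    (τ : ∀ x : Symmetrify (TableQuiver T), Walk _ o x)
    (hτ : loopClass (tableIdeal ε) τ (arrowWalk (second none)) = 1) (s t r : T) :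
    loopClass (tableIdeal ε) τ (arrowWalk (first (.inr (s, t, r)))) *
        loopClass (tableIdeal ε) τ (arrowWalk (second (some t))) =
      loopClass (tableIdeal ε) τ (arrowWalk (first (.inl r))) := by
  rw [← loopClass_twoPath, (loopClass_eq_iff τ).2 (homotopic_twoPath_none ε s t r),
    loopClass_twoPath, hτ, mul_one]

theorem loopClass_first_inl_mul {o : TableQuiver T}
    (τ : ∀ x : Symmetrify (TableQuiver T), Walk _ o x)
    (hτ : loopClass (tableIdeal ε) τ (arrowWalk (second none)) = 1) {s t r : T}
    (hε : ε (s, t, r) ≠ 0) :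
    loopClass (tableIdeal ε) τ (arrowWalk (first (.inl s))) *
        loopClass (tableIdeal ε) τ (arrowWalk (second (some t))) =
      loopClass (tableIdeal ε) τ (arrowWalk (first (.inl r))) := by
  rw [← loopClass_twoPath, ← (loopClass_eq_iff τ).2 (homotopic_twoPath_some hε),
    (loopClass_eq_iff τ).2 (homotopic_twoPath_none ε s t r), loopClass_twoPath, hτ, mul_one]

theorem exists_hom_tableWeight_eq_loopClass (hσ : IsTablePresentation σ)
    (hε : ∀ s t r, σ s * σ t = σ r → ε (s, t, r) ≠ 0) {o : T} (ho : σ o = 1) :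
    ∃ φ : M →* FundamentalGroup (tableIdeal ε) source, ∀ {x y : TableQuiver T} (a : x ⟶ y),
      φ (tableWeight σ a) = loopClass (tableIdeal ε) (baseWalk (.inl o) none) (arrowWalk a) := by
  set τ := baseWalk (F := T ⊕ T × T × T) (S := Option T) (.inl o) none
  have loop_none : loopClass (tableIdeal ε) τ (arrowWalk (second none)) = 1 :=
    loopClass_baseWalk_second _ _
  have loop_second (t : T) : loopClass (tableIdeal ε) τ (arrowWalk (second (some t))) =
      loopClass (tableIdeal ε) τ (arrowWalk (first (.inl t))) := by
    rw [← loopClass_first_inl_mul τ loop_none (hε o t t (by rw [ho, one_mul])),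
      loopClass_baseWalk_first, one_mul]
  obtain ⟨φ, hφ⟩ := hσ.exists_hom
    (fun t => loopClass (tableIdeal ε) τ (arrowWalk (first (.inl t)))) fun s t r h => by
      rw [← loop_second t, loopClass_first_inl_mul τ loop_none (hε s t r h)]
  refine ⟨φ, fun a => ?_⟩
  rcases a with (s | ⟨s, t, r⟩) | (_ | t)
  · exact hφ s
  · have loop_aux := loopClass_first_inr ε τ loop_none s t r
    rw [loop_second, ← hφ, ← hφ] at loop_aux
    exact (map_mul_inv φ _ _).trans (eq_mul_inv_of_mul_eq loop_aux).symm
  · exact (map_one φ).trans loop_none.symm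
  · exact (hφ t).trans (loop_second t).symm

theorem nonempty_fundamentalGroup_tableIdeal_mulEquiv (hσ : IsTablePresentation σ)
    (hε : ∀ s t r, ε (s, t, r) ≠ 0 ↔ σ s * σ t = σ r) (x : TableQuiver T) :
    Nonempty (FundamentalGroup (tableIdeal ε) x ≃* M) := by
  obtain ⟨o, ho⟩ := hσ.exists_eq_one
  obtain ⟨φ, hφ⟩ := exists_hom_tableWeight_eq_loopClass hσ (fun s t r => (hε s t r).2) ho
  have hω := isGrading_tableWeight fun s t r => (hε s t r).1
  exact ⟨MulEquiv.ofBijective (weightHom hω x) ⟨weightHom_injective hω hφ x,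
    weightHom_surjective hω (walkWeight_baseWalk ho) (closure_range_tableWeight hσ.closure_range)
      x⟩⟩

end FundamentalGroup

end TableHomotopy

end

end BoundQuiver

theorem mainTheorem3_general (k : Type u) [Field k] (n : ℕ) (M : Fin n → Type v)
    [∀ i, Group (M i)] [∀ i, Group.IsFinitelyPresented (M i)] :
    ∃ (A : Type u) (_ : Ring A) (_ : Algebra k A)
      (Q : Type) (_ : Quiver.{0} Q) (_ : Fintype Q)
      (ν : Fin n → (BoundQuiver.PathAlgebra k Q →ₐ[k] A)),
      BoundQuiver.IsTriangularAlgebra k A ∧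
      BoundQuiver.IsAcyclicQuiver Q ∧
      ∀ i, BoundQuiver.IsPresentation (ν i) ∧
        ∀ x : Q, Nonempty (BoundQuiver.FundamentalGroup (RingHom.ker (ν i)) x ≃* M i) := by
  classical
  choose T hT σ hσ using fun i =>
    BoundQuiver.IsTablePresentation.exists_of_isFinitelyPresented (M i)
  have (i : Fin n) : Nonempty (T i) := (hσ i).exists_eq_one.nonempty
  have hσ' (i : Fin n) : BoundQuiver.IsTablePresentation fun t : ∀ i, T i => σ i (t i) :=
    (hσ i).comp_surjective (Function.surjective_eval i)
  let ε (i : Fin n) (h : (∀ i, T i) × (∀ i, T i) × (∀ i, T i)) : k :=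
    if σ i (h.1 i) * σ i (h.2.1 i) = σ i (h.2.2 i) then 1 else 0
  have ε_ne_zero (i : Fin n) (s t r) :
      ε i (s, t, r) ≠ 0 ↔ σ i (s i) * σ i (t i) = σ i (r i) := by
    simp only [ε, ne_eq, ite_eq_right_iff, one_ne_zero, imp_false, not_not]
  refine ⟨BoundQuiver.TableAlgebra k (∀ i, T i), inferInstance, inferInstance,
    BoundQuiver.TableQuiver (∀ i, T i), inferInstance, inferInstance,
    fun i => BoundQuiver.tablePresentation (ε i), BoundQuiver.isTriangularAlgebra_tableAlgebra k _,
    BoundQuiver.TwoStepQuiver.isAcyclicQuiver,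
    fun i => ⟨BoundQuiver.isPresentation_tablePresentation (ε i), fun x => ?_⟩⟩
  rw [BoundQuiver.ker_tablePresentation]
  exact BoundQuiver.nonempty_fundamentalGroup_tableIdeal_mulEquiv (hσ' i) (ε_ne_zero i) x

theorem mainTheorem3 (k : Type u) [Field k] [IsAlgClosed k] (n : ℕ) (M : Fin n → Type v)
    [∀ i, CommGroup (M i)] [∀ i, Group.FG (M i)] :
    ∃ (A : Type u) (_ : Ring A) (_ : Algebra k A)
      (Q : Type) (_ : Quiver.{0} Q) (_ : Fintype Q)
      (ν : Fin n → (BoundQuiver.PathAlgebra k Q →ₐ[k] A)),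
      BoundQuiver.IsTriangularAlgebra k A ∧
      BoundQuiver.IsAcyclicQuiver Q ∧
      ∀ i, BoundQuiver.IsPresentation (ν i) ∧
        ∀ x : Q, Nonempty (BoundQuiver.FundamentalGroup (RingHom.ker (ν i)) x ≃* M i) :=
  mainTheorem3_general k n M
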